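/- **Theorem (path step, stable version).** *Problem and parameters.* Let $n\ge 1$, $m\ge 0$, $Q\in\mathbb R^{n\times n}$ symmetric positive semidefinite, $c\in\mathbb R^n$, $A\in\mathbb R^{m\times n}$, $b\in\mathbb R^m$, $\mathrm{tol}>0$. The method parameters are real numbers computed from these data by the following rules (each to be read as an assignment in which the value may be rounded in the indicated direction; the quantities bounded from above are positive, and $\sigma<1$; a bound with denominator $0$ is void): $$\begin{aligned} &\theta\le 0.3,\quad \beta\le\theta,\quad \sigma\ge 1-\tfrac{\beta}{\sqrt{2n}},\quad C_q\ge \|Q\|_2 n+\|c\|_2\sqrt n,\quad \omega\le\min\{\tfrac{\mathrm{tol}}{2n},\tfrac{\mathrm{tol}^2}{16(4C_q+n)},1\},\\ &C_\lambda\ge\tfrac{\|A\|_2\sqrt n+\|b\|_2}{\omega},\quad C_{\Delta\mu}\ge(\omega+\|Q\|_2)\sqrt n+\|c\|_2+\|A^T\|_2C_\lambda,\\ &\tau_A\ge\max\{\tfrac14\|Q+\omega I+\tfrac1\omega A^TA\|_2,\;4\|c-\tfrac1\omega A^Tb\|_2\},\quad \tau_E\le\tfrac{\mathrm{tol}^2\,\omega}{48\,n\max\{\|A\|_2,C_q\}},\\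 &C_\mu\ge\sqrt{2n}\,(C_{\Delta\mu}+(1+\theta)\tau_A),\quad C_z\ge\sqrt{n+C_\lambda^2+C_\mu^2}+0.1,\quad C_{gap}\le\tfrac{1-\theta}{1+C_z}\cdot\tfrac{\sigma\tau_E}{2},\\ &C_{DF}\ge\|Q\|_2+2\omega+2\|A\|_F+4+4C_z,\quad C_{DFinv}\ge\tfrac1{C_{gap}}\max\{\tfrac1\omega,\tfrac{C_z}{C_{gap}}\},\quad \kappa_{DF}\ge C_{DF}C_{DFinv},\\ &C_{\delta F}\ge C_{DF},\quad C_{\delta DF}\ge2,\quad C_{\delta\Delta z}\ge2\kappa_{DF},\\ &C_\nu\ge\max\{2C_{\delta\Delta z}(C_{\delta F}C_{DFinv}+\tfrac2\omega C_{\delta DF}C_z),\;1+C_{DFinv}C_{\delta F}\},\\ &\nu_2\le\min\{0.1,\tfrac{C_{gap}}{C_\nu},\tfrac{\omega}{2C_{\delta DF}\kappa_{DF}},\tfrac{\theta\sigma\tau_E}{2C_\nu C_{\delta F}}\},\quad \nu_1\le\tfrac{\nu_2}{C_\nu},\quad \nu_0\le\min\{\tfrac{\nu_1}{C_\nu},\tfrac{\mathrm{tol}}{2\max\{\|A\|_2,C_q\}}\}.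 \end{aligned}$$ *Neighbourhoods.* For $z=(x,\lambda,\mu_L,\mu_R)\in\mathbb R^{N}$, $N=3n+m$, and $\tau>0$ let (products of vectors componentwise, $e=(1,\dots,1)^T$) $$F_\tau(z)=\begin{pmatrix}Qx+\omega x+c-A^T\lambda-\mu_L+\mu_R\\ Ax-b+\omega\lambda\\ \mu_L(e+x)-\tau e\\ \mu_R(e-x)-\tau e\end{pmatrix}$$ and let $DF(z)$ be its Jacobian. Let $\mathcal N(\tau)$ be the set of all $z$ with $F_\tau(z)=(0,0,r^{(3)},r^{(4)})$, $\|(r^{(3)},r^{(4)})\|_2\le\theta\tau$, $\|x\|_\infty<1$ and $\mu_L,\mu_R>0$, and let $\mathcal N(\tau,\nu)=\{\tilde z:\exists z\in\mathcal N(\tau),\ \|\tilde z-z\|_2\le\nu\}$. *Computation.* A machine with unit roundoff $\varepsilon$ rounds according to the standard model: $|\mathrm{fl}(t)-t|\le\varepsilon|t|$ for every real $t$ (no overflow or underflow). The data $Q,c,A,b,\omega,\tau$ are stored rounded, and every addition, subtraction and multiplication in the evaluation of $F_\tau$ and $DF$ is rounded, the sums being formed in any order. A linear solver is stable with constant $C\ge0$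 at unit roundoff $\varepsilon$ if for every regular matrix $G$ with $C\varepsilon\|G\|_2\|G^{-1}\|_2<1$ and every vector $v$ its output $\hat u$ for the system $Gu=v$ satisfies $\|\hat u-u\|_2\le C\varepsilon\|u\|_2$ for some $u$ with $(G+\delta G)u=v+\delta v$, $\|\delta G\|_2\le C\varepsilon\|G\|_2$, $\|\delta v\|_2\le C\varepsilon\|v\|_2$. *Claim.* For all $n,m$ and $C$ there is a constant $K>0$, depending only on $n$, $m$ and $C$, such that the following holds for all problem data and all method parameters as above. Let $$K\,\varepsilon\le\frac{\nu_0}{4\,C_z\,\kappa_{DF}},\qquad \varepsilon>0,$$ let $\tau\in[\tau_E,\tau_A]$, $\hat\tau:=\sigma\tau$ and $\tilde z\in\mathcal N(\tau,\nu_0)$. Then $DF(\tilde z)$ is regular; and if, on a machine with unit roundoff $\varepsilon$, one forms $F_{\hat\tau}(\tilde z)$ and $DF(\tilde z)$, solves $DF(\tilde z)\,\Delta\tilde z=-F_{\hat\tau}(\tilde z)$ with a solver that is stable with constant $C$, and computes $\hat{\tilde z}:=\tilde z+\Delta\tilde z$, then the computed vector satisfies $\hat{\tilde z}\in\mathcal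 N(\hat\tau,\nu_1)$. -/

import Mathlib

namespace BoxQP

section Norms
open scoped Matrix.Norms.L2Operator

/-- Spectral norm (operator norm for the Euclidean norms) of a real matrix. -/
noncomputable def opNorm {ι κ : Type*} [Fintype ι] [Fintype κ] [DecidableEq κ]
    (G : Matrix ι κ ℝ) : ℝ := ‖G‖

end Norms

/-- Frobenius norm of a real matrix. -/
noncomputable def frobNorm {ι κ : Type*} [Fintype ι] [Fintype κ] (G : Matrix ι κ ℝ) : ℝ :=
  Real.sqrt (∑ i, ∑ j, G i j ^ 2)

/-- Euclidean norm of a real vector. -/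
noncomputable def norm2 {ι : Type*} [Fintype ι] (v : ι → ℝ) : ℝ := ‖WithLp.toLp 2 v‖

/-- Index set of the primal-dual vectors `z = (x, λ, μ_L, μ_R)`; it has `N = 3 n + m` elements. -/
abbrev Idx (n m : ℕ) : Type := Fin n ⊕ Fin m ⊕ Fin n ⊕ Fin n

/-- Primal-dual vectors. -/
abbrev PD (n m : ℕ) : Type := Idx n m → ℝ

namespace PD
variable {n m : ℕ}

def x (z : PD n m) (i : Fin n) : ℝ := z (.inl i)
def lam (z : PD n m) (k : Fin m) : ℝ := z (.inr (.inl k))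
def muL (z : PD n m) (i : Fin n) : ℝ := z (.inr (.inr (.inl i)))
def muR (z : PD n m) (i : Fin n) : ℝ := z (.inr (.inr (.inr i)))

end PD

/-- Data of the problem: minimize `xᵀ Q x / 2 + cᵀ x` over `‖x‖_∞ ≤ 1` with `‖A x - b‖₂` minimal,
together with the requested accuracy `tol`. -/
structure Problem (n m : ℕ) where
  Q : Matrix (Fin n) (Fin n) ℝ
  c : Fin n → ℝ
  A : Matrix (Fin m) (Fin n) ℝ
  b : Fin m → ℝ
  tol : ℝ
  posSemidef_Q : Q.PosSemidef
  tol_pos : 0 < tol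

/-- The scalar method parameters that the path-following phase refers to. -/
structure Params where
  θ : ℝ
  β : ℝ
  σ : ℝ
  Cq : ℝ
  ω : ℝ
  Clam : ℝ
  CDmu : ℝ
  τA : ℝ
  τE : ℝ
  Cmu : ℝ
  Cz : ℝ
  gap : ℝ
  CDF : ℝ
  CDFinv : ℝ
  κDF : ℝ
  CdF : ℝ
  CdDF : ℝ
  CdDz : ℝ
  Cν : ℝ
  ν2 : ℝ
  ν1 : ℝ
  ν0 : ℝ

/-- The rules by which the method parameters are computed from the data. Each rule is a one-sided
inequality (the parameter may be rounded in the indicated direction). The parameters that are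
rounded downwards stay positive, and `σ`, a reduction factor, stays below `1`. Bounds whose
denominator could vanish (`A = 0`, `C_q = 0`) are multiplied out. -/
structure Params.Admissible {n m : ℕ} (M : Params) (P : Problem n m) : Prop where
  θ_pos : 0 < M.θ
  θ_le : M.θ ≤ 0.3
  β_pos : 0 < M.β
  β_le : M.β ≤ M.θ
  σ_ge : 1 - M.β / Real.sqrt (2 * n) ≤ M.σ
  σ_lt : M.σ < 1
  Cq_ge : opNorm P.Q * n + norm2 P.c * Real.sqrt n ≤ M.Cq
  ω_pos : 0 < M.ω
  ω_le : M.ω ≤ min (P.tol / (2 * n)) (min (P.tol ^ 2 / (4 * M.Cq + n) * (1 / 16)) 1)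
  Clam_ge : (opNorm P.A * Real.sqrt n + norm2 P.b) / M.ω ≤ M.Clam
  CDmu_ge : (M.ω + opNorm P.Q) * Real.sqrt n + norm2 P.c + opNorm P.A.transpose * M.Clam ≤ M.CDmu
  τA_ge : max (opNorm (P.Q + M.ω • (1 : Matrix (Fin n) (Fin n) ℝ)
        + (1 / M.ω) • (P.A.transpose * P.A)) / 4)
      (4 * norm2 (P.c - (1 / M.ω) • P.A.transpose.mulVec P.b)) ≤ M.τA
  τE_pos : 0 < M.τE
  τE_le : M.τE * (48 * n * max (opNorm P.A) M.Cq) ≤ P.tol ^ 2 * M.ω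
  Cmu_ge : Real.sqrt (2 * n) * (M.CDmu + (1 + M.θ) * M.τA) ≤ M.Cmu
  Cz_ge : Real.sqrt (n + M.Clam ^ 2 + M.Cmu ^ 2) + 0.1 ≤ M.Cz
  gap_pos : 0 < M.gap
  gap_le : M.gap ≤ (1 - M.θ) / (1 + M.Cz) * M.σ * M.τE * (1 / 2)
  CDF_ge : opNorm P.Q + 2 * M.ω + 2 * frobNorm P.A + 4 + 4 * M.Cz ≤ M.CDF
  CDFinv_ge : 1 / M.gap * max (1 / M.ω) (M.Cz / M.gap) ≤ M.CDFinv
  κDF_ge : M.CDF * M.CDFinv ≤ M.κDF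
  CdF_ge : M.CDF ≤ M.CdF
  CdDF_ge : 2 ≤ M.CdDF
  CdDz_ge : 2 * M.κDF ≤ M.CdDz
  Cν_ge : max (2 * M.CdDz * (M.CdF * M.CDFinv + 2 / M.ω * M.CdDF * M.Cz))
      (1 + M.CDFinv * M.CdF) ≤ M.Cν
  ν2_pos : 0 < M.ν2
  ν2_le : M.ν2 ≤ min (min 0.1 (M.gap / M.Cν))
      (min (M.ω / (2 * M.CdDF * M.κDF)) (M.θ * M.σ * M.τE / (2 * M.Cν * M.CdF)))
  ν1_pos : 0 < M.ν1
  ν1_le : M.ν1 ≤ M.ν2 / M.Cν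
  ν0_pos : 0 < M.ν0
  ν0_le : M.ν0 ≤ M.ν1 / M.Cν
  ν0_le_tol : M.ν0 * (2 * max (opNorm P.A) M.Cq) ≤ P.tol

section Exact
variable {n m : ℕ}

/-- The optimality function `F_τ`. -/
def F (P : Problem n m) (ω τ : ℝ) (z : PD n m) : PD n m
  | .inl i => (∑ j, P.Q i j * z.x j) + ω * z.x i + P.c i
      - (∑ k, P.A k i * z.lam k) - z.muL i + z.muR i
  | .inr (.inl k) => (∑ j, P.A k j * z.x j) - P.b k + ω * z.lam k
  | .inr (.inr (.inl i)) => z.muL i * (1 + z.x i) - τ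
  | .inr (.inr (.inr i)) => z.muR i * (1 - z.x i) - τ

/-- The Jacobian `DF` of `F_τ`. -/
def DF (P : Problem n m) (ω : ℝ) (z : PD n m) : Matrix (Idx n m) (Idx n m) ℝ
  | .inl i, .inl j => if i = j then P.Q i j + ω else P.Q i j
  | .inl i, .inr (.inl k) => -P.A k i
  | .inl i, .inr (.inr (.inl j)) => if i = j then -1 else 0
  | .inl i, .inr (.inr (.inr j)) => if i = j then 1 else 0
  | .inr (.inl k), .inl j => P.A k j
  | .inr (.inl k), .inr (.inl l) => if k = l then ω else 0
  | .inr (.inl _), .inr (.inr _) => 0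
  | .inr (.inr (.inl i)), .inl j => if i = j then z.muL i else 0
  | .inr (.inr (.inl i)), .inr (.inr (.inl j)) => if i = j then 1 + z.x i else 0
  | .inr (.inr (.inl _)), .inr (.inl _) => 0
  | .inr (.inr (.inl _)), .inr (.inr (.inr _)) => 0
  | .inr (.inr (.inr i)), .inl j => if i = j then -z.muR i else 0
  | .inr (.inr (.inr i)), .inr (.inr (.inr j)) => if i = j then 1 - z.x i else 0
  | .inr (.inr (.inr _)), .inr (.inl _) => 0
  | .inr (.inr (.inr _)), .inr (.inr (.inl _)) => 0

/-- The neighbourhood `𝒩(τ)` of the central path. -/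
def Nbhd (P : Problem n m) (M : Params) (τ : ℝ) : Set (PD n m) :=
  {z | (∀ i, F P M.ω τ z (.inl i) = 0) ∧
    (∀ k, F P M.ω τ z (.inr (.inl k)) = 0) ∧
    norm2 (fun s : Fin n ⊕ Fin n => F P M.ω τ z (.inr (.inr s))) ≤ M.θ * τ ∧
    (∀ i, |z.x i| < 1) ∧ (∀ i, 0 < z.muL i) ∧ (∀ i, 0 < z.muR i)}

/-- The enveloped neighbourhood `𝒩(τ, ν)`. -/
def EnvNbhd (P : Problem n m) (M : Params) (τ ν : ℝ) : Set (PD n m) :=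
  {w | ∃ z ∈ Nbhd P M τ, norm2 (w - z) ≤ ν}

end Exact

section FloatingPoint

/-- The standard model of floating-point arithmetic with unit roundoff `ε`: rounding a real number
(the exact result of one operation, or a datum to be stored) has relative error at most `ε`. -/
def IsRounding (ε : ℝ) (fl : ℝ → ℝ) : Prop := ∀ t, |fl t - t| ≤ ε * |t|

/-- Binary floating-point numbers with `p` bits of precision. -/
def binaryFloats (p : ℕ) : Set ℝ :=
  {t | ∃ k e : ℤ, |k| ≤ 2 ^ p ∧ t = (k : ℝ) * (2 : ℝ) ^ e}

/-- IEEE rounding to a nearest binary floating-point number (any tie-breaking rule) satisfies the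
standard model with unit roundoff `2⁻ᵖ`. -/
theorem isRounding_of_nearest (p : ℕ) (fl : ℝ → ℝ)
    (hfl : ∀ t, ∀ s ∈ binaryFloats p, |fl t - t| ≤ |s - t|) :
    IsRounding ((2 : ℝ) ^ (-(p : ℤ))) fl := by
  intro t
  by_cases ht : t = 0
  · subst ht
    have := hfl 0 0 ⟨0, 0, by positivity, by simp⟩
    simpa using this
  have hpos : 0 < |t| := abs_pos.mpr ht
  set e : ℤ := Int.log 2 |t| - (p - 1) with he
  have h2 : (2 : ℝ) ≠ 0 := two_ne_zero
  have hepos : (0 : ℝ) < 2 ^ e := by positivity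
  have h1 : (2 : ℝ) ^ (Int.log 2 |t|) ≤ |t| := by
    simpa using Int.zpow_log_le_self (b := 2) (by norm_num) hpos
  have h3 : |t| < (2 : ℝ) ^ (Int.log 2 |t| + 1) := by
    simpa using Int.lt_zpow_succ_log_self (b := 2) (by norm_num) |t|
  have hlow : (2 : ℝ) ^ e ≤ 2 * ((2 : ℝ) ^ (-(p : ℤ)) * |t|) := by
    have : (2 : ℝ) ^ e = 2 * ((2 : ℝ) ^ (-(p : ℤ)) * (2 : ℝ) ^ (Int.log 2 |t|)) := by
      rw [← zpow_add₀ h2, ← zpow_one_add₀ h2]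
      congr 1
      omega
    rw [this]
    gcongr
  have hup : |t| < (2 : ℝ) ^ (p : ℤ) * 2 ^ e := by
    rw [← zpow_add₀ h2]
    convert h3 using 2
    omega
  have hround := abs_sub_round (t / 2 ^ e)
  have hq : |t / 2 ^ e| < (2 : ℝ) ^ p := by
    rw [abs_div, abs_of_pos hepos, div_lt_iff₀ hepos]
    simpa using hup
  have hk : |round (t / 2 ^ e)| ≤ (2 : ℤ) ^ p := by
    have hlt : ((|round (t / 2 ^ e)| : ℤ) : ℝ) < ((2 ^ p + 1 : ℤ) : ℝ) := by
      push_cast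
      have h := abs_sub_abs_le_abs_sub ((round (t / 2 ^ e) : ℤ) : ℝ) (t / 2 ^ e)
      rw [abs_sub_comm] at h
      linarith
    have := Int.cast_lt.mp hlt
    omega
  refine (hfl t _ ⟨round (t / 2 ^ e), e, hk, rfl⟩).trans ?_
  have heq : (round (t / 2 ^ e) : ℝ) * 2 ^ e - t = -((t / 2 ^ e - round (t / 2 ^ e)) * 2 ^ e) := by
    field_simp
    ring
  rw [heq, abs_neg, abs_mul, abs_of_pos hepos]
  nlinarith

/-- `FlSum fl s r`: the terms in `s`, summed in some order and with some bracketing, every addition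
being rounded by `fl`, give the result `r`. -/
inductive FlSum (fl : ℝ → ℝ) : Multiset ℝ → ℝ → Prop
  | single (t : ℝ) : FlSum fl {t} t
  | add {s₁ s₂ : Multiset ℝ} {r₁ r₂ : ℝ} :
      FlSum fl s₁ r₁ → FlSum fl s₂ r₂ → FlSum fl (s₁ + s₂) (fl (r₁ + r₂))

variable {n m : ℕ}

/-- `r` is a machine evaluation of `F_τ(z)`: the data and `τ` are stored as rounded numbers, every
multiplication, addition and subtraction is rounded, and sums are formed in any order. -/
structure IsComputedF (fl : ℝ → ℝ) (P : Problem n m) (ω τ : ℝ) (z r : PD n m) : Prop where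
  first : ∀ i, FlSum fl
    ((Finset.univ.val.map fun j => fl (fl (P.Q i j) * z.x j))
      + {fl (fl ω * z.x i)} + {fl (P.c i)}
      + (Finset.univ.val.map fun k => -fl (fl (P.A k i) * z.lam k))
      + {-z.muL i} + {z.muR i}) (r (.inl i))
  second : ∀ k, FlSum fl
    ((Finset.univ.val.map fun j => fl (fl (P.A k j) * z.x j))
      + {-fl (P.b k)} + {fl (fl ω * z.lam k)}) (r (.inr (.inl k)))
  third : ∀ i, r (.inr (.inr (.inl i))) = fl (fl (z.muL i * fl (1 + z.x i)) - fl τ)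
  fourth : ∀ i, r (.inr (.inr (.inr i))) = fl (fl (z.muR i * fl (1 - z.x i)) - fl τ)

/-- Machine evaluation of `DF(z)`. -/
def computedDF (fl : ℝ → ℝ) (P : Problem n m) (ω : ℝ) (z : PD n m) :
    Matrix (Idx n m) (Idx n m) ℝ
  | .inl i, .inl j => if i = j then fl (fl (P.Q i j) + fl ω) else fl (P.Q i j)
  | .inl i, .inr (.inl k) => -fl (P.A k i)
  | .inl i, .inr (.inr (.inl j)) => if i = j then -1 else 0
  | .inl i, .inr (.inr (.inr j)) => if i = j then 1 else 0
  | .inr (.inl k), .inl j => fl (P.A k j)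
  | .inr (.inl k), .inr (.inl l) => if k = l then fl ω else 0
  | .inr (.inl _), .inr (.inr _) => 0
  | .inr (.inr (.inl i)), .inl j => if i = j then z.muL i else 0
  | .inr (.inr (.inl i)), .inr (.inr (.inl j)) => if i = j then fl (1 + z.x i) else 0
  | .inr (.inr (.inl _)), .inr (.inl _) => 0
  | .inr (.inr (.inl _)), .inr (.inr (.inr _)) => 0
  | .inr (.inr (.inr i)), .inl j => if i = j then -z.muR i else 0
  | .inr (.inr (.inr i)), .inr (.inr (.inr j)) => if i = j then fl (1 - z.x i) else 0
  | .inr (.inr (.inr _)), .inr (.inl _) => 0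
  | .inr (.inr (.inr _)), .inr (.inr (.inl _)) => 0

/-- Numerical stability, with constant `C`, of a solver for square linear systems `G u = v` on a
machine with unit roundoff `ε`: the computed vector is nearly the exact solution `u` of a nearby
system, all relative perturbations being at most `C ε` (mixed forward-backward stability;
backward stability is the case `solve G v = u`). It is only required for matrices that are
regular to working precision. -/
def IsStableSolver {ι : Type*} [Fintype ι] [DecidableEq ι] (C ε : ℝ)
    (solve : Matrix ι ι ℝ → (ι → ℝ) → (ι → ℝ)) : Prop :=
  ∀ (G : Matrix ι ι ℝ) (v : ι → ℝ), IsUnit G.det → C * ε * (opNorm G * opNorm G⁻¹) < 1 →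
    ∃ (δG : Matrix ι ι ℝ) (δv u : ι → ℝ),
      opNorm δG ≤ C * ε * opNorm G ∧
      norm2 δv ≤ C * ε * norm2 v ∧
      (G + δG).mulVec u = v + δv ∧
      norm2 (solve G v - u) ≤ C * ε * norm2 u

/-- `zhat` is a result of the Newton step for `F_τ` from `z`, computed on the machine: form the
residual and the Jacobian, solve `DF(z) Δz = -F_τ(z)` with the given solver, add `Δz` to `z`. -/
def IsComputedNewtonStep (fl : ℝ → ℝ)
    (solve : Matrix (Idx n m) (Idx n m) ℝ → (Idx n m → ℝ) → (Idx n m → ℝ))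
    (P : Problem n m) (ω τ : ℝ) (z zhat : PD n m) : Prop :=
  ∃ r : PD n m, IsComputedF fl P ω τ z r ∧
    ∀ k, zhat k = fl (z k + solve (computedDF fl P ω z) (-r) k)

end FloatingPoint

end BoxQP

open BoxQP

/-! `F` is quadratic in `z`, so its Taylor expansion with the bilinear form `bil` is exact.
Everything rests on this and on a lower bound for the Jacobian.

Exact step from a point of `Nbhd`: after a full Newton step the residual is `bil w w / 2`. It
vanishes in the two linear blocks and equals the products `dμ i * ds i` in the complementarity
blocks. Semidefiniteness of `Q` and `ω > 0` make the sum of these products nonnegative, and the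
arithmetic-geometric mean inequality bounds each of them from above. Together this bounds their norm
by `θ * (σ * τ)` (`norm2_mul_le_of_newton`), and positivity of the new iterate follows algebraically
(`newton_pos`, `Nbhd.add_mem`).

Conditioning: divide the complementarity rows by the multipliers and test with `u`. The skew
couplings cancel and a coercive diagonal form remains, so `norm2 u ≤ CDFinv * norm2 (DF z u)`
wherever slacks and multipliers are at least `gap` (`norm2_le_mul_norm2_DF_mulVec`). Points of
`Nbhd` keep distance `2 * gap` (`Nbhd.gap_le`), hence points within `ν0` still keep `gap`. This
gives regularity of the Jacobian.

Perturbed start: the Newton images of `z` and of a nearby `z₀` differ by a vector that `DF z` maps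
to quadratic terms of size at most `CDF * ν0`. By the choice of `Cν`, the images are at most `ν1 /
4` apart.

Rounding: residual and Jacobian have errors of order `ε * CDF * Cz` and `ε * CDF`, with factors
depending on `n` and `m` only. A stable solver turns them into an error of order `ε * κDF * Cz` in
the step (`IsStableSolver.norm2_solve_sub_le`), and the final addition costs no more. For large `K`
this is at most `ν0 / 4`, which fits beside `ν1 / 4` within `ν1`. -/

namespace BoxQP

/-! ### Euclidean and operator norms. -/

section NormLemmas
variable {ι κ : Type*} [Fintype ι] [Fintype κ]

theorem norm2_nonneg (v : ι → ℝ) : 0 ≤ norm2 v := norm_nonneg _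

theorem norm2_sq (v : ι → ℝ) : norm2 v ^ 2 = ∑ i, v i ^ 2 := by
  simp [norm2, EuclideanSpace.norm_sq_eq]

theorem norm2_zero : norm2 (0 : ι → ℝ) = 0 := by simp [norm2]

theorem norm2_neg (v : ι → ℝ) : norm2 (-v) = norm2 v := by simp [norm2]

theorem norm2_add_le (v w : ι → ℝ) : norm2 (v + w) ≤ norm2 v + norm2 w := by
  simpa [norm2] using norm_add_le (WithLp.toLp 2 v) (WithLp.toLp 2 w)

theorem norm2_sub_le (v w : ι → ℝ) : norm2 (v - w) ≤ norm2 v + norm2 w := by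
  simpa [norm2] using norm_sub_le (WithLp.toLp 2 v) (WithLp.toLp 2 w)

theorem norm2_sub_comm (v w : ι → ℝ) : norm2 (v - w) = norm2 (w - v) := by
  rw [← norm2_neg, neg_sub]

theorem norm2_smul (a : ℝ) (v : ι → ℝ) : norm2 (a • v) = |a| * norm2 v := by
  simp [norm2, norm_smul]

theorem norm2_eq_zero {v : ι → ℝ} : norm2 v = 0 ↔ v = 0 := by
  simp [norm2]

theorem norm2_le_of_sq_le {v : ι → ℝ} {a : ℝ} (ha : 0 ≤ a) (h : ∑ i, v i ^ 2 ≤ a ^ 2) :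
    norm2 v ≤ a := by
  rw [← norm2_sq] at h
  exact le_of_sq_le_sq h ha

theorem abs_le_norm2 (v : ι → ℝ) (i : ι) : |v i| ≤ norm2 v := by
  simpa [norm2] using PiLp.norm_apply_le (WithLp.toLp 2 v) i

theorem norm2_le_mul_of_abs_le {v w : ι → ℝ} {a : ℝ} (ha : 0 ≤ a)
    (h : ∀ i, |v i| ≤ a * |w i|) : norm2 v ≤ a * norm2 w := by
  apply norm2_le_of_sq_le (mul_nonneg ha (norm2_nonneg w))
  rw [mul_pow, norm2_sq, Finset.mul_sum]
  refine Finset.sum_le_sum fun i _ => ?_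
  rw [← sq_abs, ← sq_abs (w i), ← mul_pow]
  exact pow_le_pow_left₀ (abs_nonneg _) (h i) 2

/-- The factor is the cardinality rather than its root; dimension factors are absorbed in `K`, so
the cruder form suffices. -/
theorem norm2_le_card_mul {v : ι → ℝ} {a : ℝ} (h : ∀ i, |v i| ≤ a) :
    norm2 v ≤ Fintype.card ι * a := by
  rcases isEmpty_or_nonempty ι with hι | hι
  · simp [norm2_eq_zero.2 (Subsingleton.elim v 0)]
  have ha : 0 ≤ a := (abs_nonneg _).trans (h (Classical.arbitrary ι))
  have hc : (1 : ℝ) ≤ Fintype.card ι := by exact_mod_cast Fintype.card_pos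
  apply norm2_le_of_sq_le (by positivity)
  calc ∑ i, v i ^ 2 ≤ ∑ _i : ι, a ^ 2 := by
        refine Finset.sum_le_sum fun i _ => ?_
        rw [← sq_abs]
        exact pow_le_pow_left₀ (abs_nonneg _) (h i) 2
    _ = Fintype.card ι * a ^ 2 := by simp
    _ ≤ (Fintype.card ι * a) ^ 2 := by nlinarith [sq_nonneg a]

theorem sum_mul_le_norm2_mul (v w : ι → ℝ) : ∑ i, v i * w i ≤ norm2 v * norm2 w := by
  have h := Real.sum_mul_le_sqrt_mul_sqrt Finset.univ v w
  rwa [← norm2_sq, ← norm2_sq, Real.sqrt_sq (norm2_nonneg v), Real.sqrt_sq (norm2_nonneg w)] at h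

section
open scoped Matrix.Norms.L2Operator

theorem opNorm_nonneg [DecidableEq κ] (G : Matrix ι κ ℝ) : 0 ≤ opNorm G := norm_nonneg G

theorem norm2_mulVec_le [DecidableEq κ] (G : Matrix ι κ ℝ) (v : κ → ℝ) :
    norm2 (G.mulVec v) ≤ opNorm G * norm2 v := by
  simpa [norm2, opNorm] using Matrix.l2_opNorm_mulVec G (WithLp.toLp 2 v)

theorem opNorm_le_of_forall [DecidableEq κ] {G : Matrix ι κ ℝ} {a : ℝ} (ha : 0 ≤ a)
    (h : ∀ v, norm2 (G.mulVec v) ≤ a * norm2 v) : opNorm G ≤ a := by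
  unfold opNorm
  rw [Matrix.l2_opNorm_def]
  refine ContinuousLinearMap.opNorm_le_bound _ ha fun v => ?_
  exact h v.ofLp

theorem abs_apply_le_opNorm [DecidableEq κ] (G : Matrix ι κ ℝ) (i : ι) (j : κ) : |G i j| ≤ opNorm G := by
  have h1 := norm2_mulVec_le G (Pi.single j 1)
  have h2 := abs_le_norm2 (G.mulVec (Pi.single j 1)) i
  have h3 : norm2 (Pi.single j (1 : ℝ)) = 1 := by
    simp [norm2]
  rw [h3, mul_one] at h1
  have h4 : G.mulVec (Pi.single j 1) i = G i j := by simp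
  rw [h4] at h2
  exact h2.trans h1

end

theorem norm2_mulVec_le_of_abs_le {G : Matrix ι κ ℝ} {a : ℝ} (h : ∀ i j, |G i j| ≤ a)
    (v : κ → ℝ) :
    norm2 (G.mulVec v) ≤ (Fintype.card ι * Fintype.card κ : ℝ) * a * norm2 v := by
  have := norm2_le_card_mul (v := G.mulVec v) (a := Fintype.card κ * (a * norm2 v)) fun i => ?_
  · linarith
  calc |G.mulVec v i| = |∑ j, G i j * v j| := rfl
    _ ≤ ∑ j, |G i j * v j| := Finset.abs_sum_le_sum_abs _ _
    _ ≤ ∑ _j : κ, a * norm2 v := by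
        refine Finset.sum_le_sum fun j _ => ?_
        rw [abs_mul]
        exact mul_le_mul (h i j) (abs_le_norm2 v j) (abs_nonneg _) ((abs_nonneg _).trans (h i j))
    _ = Fintype.card κ * (a * norm2 v) := by simp

theorem abs_apply_le_frobNorm (G : Matrix ι κ ℝ) (i : ι) (j : κ) :
    |G i j| ≤ frobNorm G := by
  apply Real.abs_le_sqrt
  calc G i j ^ 2 ≤ ∑ j, G i j ^ 2 :=
        Finset.single_le_sum (f := fun j => G i j ^ 2) (fun _ _ => sq_nonneg _) (Finset.mem_univ j)
    _ ≤ _ := Finset.single_le_sum (f := fun i => ∑ j, G i j ^ 2)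
        (fun _ _ => Finset.sum_nonneg fun _ _ => sq_nonneg _) (Finset.mem_univ i)

/-- A lower bound of this kind is the form in which regularity and conditioning are carried
throughout: it survives perturbation of `G` and needs no inverse. -/
theorem isUnit_det_of_norm2_le [DecidableEq ι] {G : Matrix ι ι ℝ} {a : ℝ}
    (h : ∀ v, norm2 v ≤ a * norm2 (G.mulVec v)) : IsUnit G.det := by
  rw [← Matrix.isUnit_iff_isUnit_det, ← Matrix.mulVec_injective_iff_isUnit]
  intro v w hvw
  have h1 := h (v - w)
  rw [Matrix.mulVec_sub, hvw, sub_self, norm2_zero, mul_zero] at h1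
  exact sub_eq_zero.1 (norm2_eq_zero.1 (le_antisymm h1 (norm2_nonneg _)))

theorem opNorm_inv_le [DecidableEq ι] {G : Matrix ι ι ℝ} {a : ℝ} (ha : 0 ≤ a)
    (h : ∀ v, norm2 v ≤ a * norm2 (G.mulVec v)) : opNorm G⁻¹ ≤ a := by
  refine opNorm_le_of_forall ha fun v => ?_
  have h1 := h (G⁻¹.mulVec v)
  rwa [Matrix.mulVec_mulVec, Matrix.mul_nonsing_inv _ (isUnit_det_of_norm2_le h),
    Matrix.one_mulVec] at h1

theorem exists_mulVec_eq [DecidableEq ι] {G : Matrix ι ι ℝ} (h : IsUnit G.det) (v : ι → ℝ) :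
    ∃ u, G.mulVec u = v :=
  ⟨G⁻¹.mulVec v, by rw [Matrix.mulVec_mulVec, Matrix.mul_nonsing_inv _ h, Matrix.one_mulVec]⟩

end NormLemmas

/-! ### Block structure of the Jacobian, exact Taylor expansion, coercivity. -/

section Blocks
variable {n m : ℕ}

theorem sum_idx (f : Idx n m → ℝ) : ∑ s, f s = ∑ i, f (.inl i) + (∑ k, f (.inr (.inl k))
    + (∑ i, f (.inr (.inr (.inl i))) + ∑ i, f (.inr (.inr (.inr i))))) := by
  simp [Fintype.sum_sum_type]

/-- The bilinear form through which the Jacobian depends on its argument. -/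
def bil (d u : PD n m) : PD n m
  | .inl _ => 0
  | .inr (.inl _) => 0
  | .inr (.inr (.inl i)) => d.muL i * u.x i + d.x i * u.muL i
  | .inr (.inr (.inr i)) => -(d.muR i * u.x i) - d.x i * u.muR i

variable (P : Problem n m) (ω τ : ℝ) (z d u : PD n m)

theorem DF_mulVec_inl (i : Fin n) : (DF P ω z).mulVec u (.inl i) =
    (∑ j, P.Q i j * u.x j) + ω * u.x i - (∑ k, P.A k i * u.lam k) - u.muL i + u.muR i := by
  have h : ∀ j, (if i = j then P.Q i j + ω else P.Q i j) * u (.inl j)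
      = P.Q i j * u (.inl j) + if i = j then ω * u (.inl j) else 0 := by
    intro j; split_ifs <;> ring
  simp only [Matrix.mulVec, dotProduct, sum_idx, DF, h, Finset.sum_add_distrib]
  simp [PD.x, PD.lam, PD.muL, PD.muR, ite_mul]
  ring

theorem DF_mulVec_lam (k : Fin m) : (DF P ω z).mulVec u (.inr (.inl k)) =
    (∑ j, P.A k j * u.x j) + ω * u.lam k := by
  simp [Matrix.mulVec, dotProduct, DF, PD.x, PD.lam, ite_mul]

theorem DF_mulVec_muL (i : Fin n) : (DF P ω z).mulVec u (.inr (.inr (.inl i))) =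
    z.muL i * u.x i + (1 + z.x i) * u.muL i := by
  simp [Matrix.mulVec, dotProduct, DF, PD.x, PD.muL, ite_mul]

theorem DF_mulVec_muR (i : Fin n) : (DF P ω z).mulVec u (.inr (.inr (.inr i))) =
    -(z.muR i * u.x i) + (1 - z.x i) * u.muR i := by
  simp [Matrix.mulVec, dotProduct, DF, PD.x, PD.muR, ite_mul]

theorem DF_add_mulVec :
    (DF P ω (z + d)).mulVec u = (DF P ω z).mulVec u + bil d u := by
  funext s
  rcases s with i | k | i | i
  · simp [DF_mulVec_inl, bil]
  · simp [DF_mulVec_lam, bil]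
  · simp only [Pi.add_apply, DF_mulVec_muL, bil, PD.x, PD.muL]; ring
  · simp only [Pi.add_apply, DF_mulVec_muR, bil, PD.x, PD.muR]; ring

/-- There is no remainder because the only nonlinear terms are products of a multiplier and a slack.
-/
theorem F_add : F P ω τ (z + d) = F P ω τ z + (DF P ω z).mulVec d + (1 / 2 : ℝ) • bil d d := by
  funext s
  rcases s with i | k | i | i
  · simp only [Pi.add_apply, Pi.smul_apply, DF_mulVec_inl, bil, F, PD.x, PD.muL, PD.muR, PD.lam,
      mul_add, Finset.sum_add_distrib, smul_eq_mul]
    ring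
  · simp only [Pi.add_apply, Pi.smul_apply, DF_mulVec_lam, bil, F, PD.x, PD.lam,
      mul_add, Finset.sum_add_distrib, smul_eq_mul]
    ring
  · simp only [Pi.add_apply, Pi.smul_apply, DF_mulVec_muL, bil, F, PD.x, PD.muL, smul_eq_mul]
    ring
  · simp only [Pi.add_apply, Pi.smul_apply, DF_mulVec_muR, bil, F, PD.x, PD.muR, smul_eq_mul]
    ring

theorem norm2_sq_eq : norm2 u ^ 2 = ∑ i, u.x i ^ 2 + (∑ k, u.lam k ^ 2
    + (∑ i, u.muL i ^ 2 + ∑ i, u.muR i ^ 2)) := by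
  rw [norm2_sq, sum_idx]; rfl

/-- Each nonzero entry is a sum of two products, which costs a factor 2 under the square; the
entries of `u.x` occur in both complementarity blocks, which costs another. -/
theorem norm2_bil_le : norm2 (bil d u) ≤ 2 * norm2 d * norm2 u := by
  have hd := norm2_nonneg d
  apply norm2_le_of_sq_le (by have := norm2_nonneg u; positivity)
  have key : ∀ {a b p q : ℝ}, |a| ≤ norm2 d → |b| ≤ norm2 d →
      (a * p + b * q) ^ 2 ≤ 2 * norm2 d ^ 2 * (p ^ 2 + q ^ 2) := by
    intro a b p q ha hb
    have h1 : a ^ 2 ≤ norm2 d ^ 2 := by rw [← sq_abs]; exact pow_le_pow_left₀ (abs_nonneg _) ha 2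
    have h2 : b ^ 2 ≤ norm2 d ^ 2 := by rw [← sq_abs]; exact pow_le_pow_left₀ (abs_nonneg _) hb 2
    nlinarith [sq_nonneg (a * p - b * q), mul_le_mul_of_nonneg_right h1 (sq_nonneg p),
      mul_le_mul_of_nonneg_right h2 (sq_nonneg q)]
  have hL : ∑ i, bil d u (.inr (.inr (.inl i))) ^ 2
      ≤ ∑ i, 2 * norm2 d ^ 2 * (u.x i ^ 2 + u.muL i ^ 2) :=
    Finset.sum_le_sum fun i _ => key (abs_le_norm2 d _) (abs_le_norm2 d _)
  have hR : ∑ i, bil d u (.inr (.inr (.inr i))) ^ 2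
      ≤ ∑ i, 2 * norm2 d ^ 2 * (u.x i ^ 2 + u.muR i ^ 2) := by
    refine Finset.sum_le_sum fun i _ => ?_
    have := key (a := d.muR i) (b := d.x i) (p := u.x i) (q := u.muR i)
      (abs_le_norm2 d _) (abs_le_norm2 d _)
    simp only [bil]
    linarith
  have h0 : ∀ i, bil d u (.inl i) = 0 := fun _ => rfl
  have h1 : ∀ k, bil d u (.inr (.inl k)) = 0 := fun _ => rfl
  rw [sum_idx]
  simp only [h0, h1, mul_pow, norm2_sq_eq u]
  rw [← Finset.mul_sum, Finset.sum_add_distrib] at hL hR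
  have hl : 0 ≤ ∑ k, u.lam k ^ 2 := Finset.sum_nonneg fun _ _ => sq_nonneg _
  have hl : 0 ≤ ∑ i, u.muL i ^ 2 := Finset.sum_nonneg fun _ _ => sq_nonneg _
  have hl : 0 ≤ ∑ i, u.muR i ^ 2 := Finset.sum_nonneg fun _ _ => sq_nonneg _
  simp
  nlinarith [sq_nonneg (norm2 d)]

/-- The Jacobian is bounded below in terms of the distance of `z` from the boundary. -/
theorem norm2_le_mul_norm2_DF_mulVec {g Z B : ℝ} (hg : 0 < g) (hg1 : g ≤ 1) (hω : 0 < ω)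
    (hZ : 0 < Z) (hB1 : 1 / ω ≤ g * B) (hB2 : Z / g ≤ g * B)
    (hxL : ∀ i, g ≤ 1 + z.x i) (hxR : ∀ i, g ≤ 1 - z.x i)
    (hL : ∀ i, g ≤ z.muL i ∧ z.muL i ≤ Z) (hR : ∀ i, g ≤ z.muR i ∧ z.muR i ≤ Z) :
    norm2 u ≤ B * norm2 ((DF P ω z).mulVec u) := by
  set v := (DF P ω z).mulVec u with hv
  -- Scaling the complementarity rows by the inverse multipliers makes their couplings with `x` the
  -- negatives of those in the first row, so they cancel in the product of `u` and `w`.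
  set w : PD n m := fun s => match s with
    | .inl i => v (.inl i)
    | .inr (.inl k) => v (.inr (.inl k))
    | .inr (.inr (.inl i)) => v (.inr (.inr (.inl i))) / z.muL i
    | .inr (.inr (.inr i)) => v (.inr (.inr (.inr i))) / z.muR i with hw
  have hgB : 0 < g * B := lt_of_lt_of_le (by positivity) hB1
  have hB : 0 < B := pos_of_mul_pos_right hgB hg.le
  -- `1 / (g * B)` is a common lower bound for all diagonal coefficients of the scaled form: `ω` and
  -- the quotients of slack by multiplier.
  have hδ1 : 1 / (g * B) ≤ ω := by
    rw [div_le_iff₀ hgB]; rw [div_le_iff₀ hω] at hB1; linarith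
  have hδ2 : ∀ {s μ : ℝ}, g ≤ s → g ≤ μ → μ ≤ Z → 1 / (g * B) ≤ s / μ := by
    intro s μ h1 h2 h3
    rw [div_le_div_iff₀ hgB (by linarith)]
    rw [div_le_iff₀ hg] at hB2
    nlinarith
  have hwv : norm2 w ≤ 1 / g * norm2 v := by
    apply norm2_le_mul_of_abs_le (by positivity)
    have h1g : 1 ≤ 1 / g := by rw [le_div_iff₀ hg]; linarith
    have hd : ∀ {a μ : ℝ}, g ≤ μ → |a / μ| ≤ 1 / g * |a| := by
      intro a μ h
      rw [abs_div, abs_of_pos (hg.trans_le h), div_eq_mul_inv, mul_comm, ← one_div]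
      gcongr
    rintro (i | k | i | i)
    · exact le_mul_of_one_le_left (abs_nonneg _) h1g
    · exact le_mul_of_one_le_left (abs_nonneg _) h1g
    · exact hd (hL i).1
    · exact hd (hR i).1
  have hQ : 0 ≤ ∑ i, u.x i * ∑ j, P.Q i j * u.x j := by
    have := P.posSemidef_Q.dotProduct_mulVec_nonneg u.x
    simpa [dotProduct, Matrix.mulVec] using this
  have hA : ∑ i, u.x i * ∑ k, P.A k i * u.lam k = ∑ k, u.lam k * ∑ j, P.A k j * u.x j := by
    simp only [Finset.mul_sum]
    rw [Finset.sum_comm]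
    exact Finset.sum_congr rfl fun _ _ => Finset.sum_congr rfl fun _ _ => by ring
  have e1 : ∑ i, u (.inl i) * w (.inl i) = ∑ i, u.x i * (∑ j, P.Q i j * u.x j)
      + ω * ∑ i, u.x i ^ 2 - ∑ i, u.x i * (∑ k, P.A k i * u.lam k)
      - ∑ i, u.x i * u.muL i + ∑ i, u.x i * u.muR i := by
    rw [Finset.mul_sum, ← Finset.sum_add_distrib, ← Finset.sum_sub_distrib,
      ← Finset.sum_sub_distrib, ← Finset.sum_add_distrib]
    refine Finset.sum_congr rfl fun i _ => ?_
    simp only [hw, hv, DF_mulVec_inl]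
    simp only [PD.x]
    ring
  have e2 : ∑ k, u (.inr (.inl k)) * w (.inr (.inl k)) =
      ∑ k, u.lam k * (∑ j, P.A k j * u.x j) + ω * ∑ k, u.lam k ^ 2 := by
    rw [Finset.mul_sum, ← Finset.sum_add_distrib]
    refine Finset.sum_congr rfl fun i _ => ?_
    simp only [hw, hv, DF_mulVec_lam]
    simp only [PD.lam]
    ring
  have e3 : ∑ i, u.x i * u.muL i + 1 / (g * B) * ∑ i, u.muL i ^ 2
      ≤ ∑ i, u (.inr (.inr (.inl i))) * w (.inr (.inr (.inl i))) := by
    rw [Finset.mul_sum, ← Finset.sum_add_distrib]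
    refine Finset.sum_le_sum fun i _ => ?_
    have hμ : 0 < z.muL i := hg.trans_le (hL i).1
    have : u (.inr (.inr (.inl i))) * w (.inr (.inr (.inl i))) =
        u.x i * u.muL i + (1 + z.x i) / z.muL i * u.muL i ^ 2 := by
      simp only [hw, hv, DF_mulVec_muL]
      simp only [PD.muL] at hμ ⊢
      field_simp
    rw [this, add_le_add_iff_left]
    refine mul_le_mul_of_nonneg_right ?_ (sq_nonneg _)
    exact hδ2 (hxL i) (hL i).1 (hL i).2
  have e4 : -∑ i, u.x i * u.muR i + 1 / (g * B) * ∑ i, u.muR i ^ 2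
      ≤ ∑ i, u (.inr (.inr (.inr i))) * w (.inr (.inr (.inr i))) := by
    rw [Finset.mul_sum, ← Finset.sum_neg_distrib, ← Finset.sum_add_distrib]
    refine Finset.sum_le_sum fun i _ => ?_
    have hμ : 0 < z.muR i := hg.trans_le (hR i).1
    have : u (.inr (.inr (.inr i))) * w (.inr (.inr (.inr i))) =
        -(u.x i * u.muR i) + (1 - z.x i) / z.muR i * u.muR i ^ 2 := by
      simp only [hw, hv, DF_mulVec_muR]
      simp only [PD.muR] at hμ ⊢
      field_simp
    rw [this, add_le_add_iff_left]
    refine mul_le_mul_of_nonneg_right ?_ (sq_nonneg _)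
    exact hδ2 (hxR i) (hR i).1 (hR i).2
  have hx : 1 / (g * B) * ∑ i, u.x i ^ 2 ≤ ω * ∑ i, u.x i ^ 2 :=
    mul_le_mul_of_nonneg_right hδ1 (Finset.sum_nonneg fun _ _ => sq_nonneg _)
  have hl : 1 / (g * B) * ∑ k, u.lam k ^ 2 ≤ ω * ∑ k, u.lam k ^ 2 :=
    mul_le_mul_of_nonneg_right hδ1 (Finset.sum_nonneg fun _ _ => sq_nonneg _)
  have key : 1 / (g * B) * norm2 u ^ 2 ≤ norm2 u * (1 / g * norm2 v) := by
    refine le_trans ?_ ((sum_mul_le_norm2_mul u w).trans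
      (mul_le_mul_of_nonneg_left hwv (norm2_nonneg u)))
    rw [sum_idx, norm2_sq_eq]
    linarith
  rcases (norm2_nonneg u).eq_or_lt with h0 | h0
  · rw [← h0]; exact mul_nonneg hB.le (norm2_nonneg v)
  · have h1 : norm2 u * (1 / (g * B) * norm2 u) ≤ norm2 u * (1 / g * norm2 v) := by
      linarith [key]
    have h2 := le_of_mul_le_mul_left h1 h0
    rw [one_div_mul_eq_div, div_le_iff₀ hgB] at h2
    field_simp at h2
    linarith

end Blocks

/-! ### Second-order error and positivity of a centring step. -/

theorem sum_sq_le_of_sum_nonneg {ι : Type*} [Fintype ι] {t g : ι → ℝ} (hg : ∀ i, 0 ≤ g i)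
    (htg : ∀ i, t i ≤ g i) (ht : 0 ≤ ∑ i, t i) : ∑ i, t i ^ 2 ≤ 2 * (∑ i, g i) ^ 2 := by
  have h1 : ∀ i, t i ^ 2 = max (t i) 0 ^ 2 + max (-t i) 0 ^ 2 := by
    intro i
    rcases le_total 0 (t i) with h | h
    · rw [max_eq_left h, max_eq_right (by linarith)]; ring
    · rw [max_eq_right h, max_eq_left (by linarith)]; ring
  have h2 : ∑ i, t i = ∑ i, max (t i) 0 - ∑ i, max (-t i) 0 := by
    rw [← Finset.sum_sub_distrib]
    refine Finset.sum_congr rfl fun i _ => ?_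
    rcases le_total 0 (t i) with h | h
    · rw [max_eq_left h, max_eq_right (by linarith)]; ring
    · rw [max_eq_right h, max_eq_left (by linarith)]; ring
  -- The positive parts are controlled by `g`, and the negative parts sum to no more than the
  -- positive ones because the total is nonnegative. Each contributes one square, hence the factor
  -- 2.
  have h3 : ∑ i, max (t i) 0 ≤ ∑ i, g i :=
    Finset.sum_le_sum fun i _ => max_le (htg i) (hg i)
  have h4 : ∑ i, max (t i) 0 ^ 2 ≤ (∑ i, max (t i) 0) ^ 2 :=
    Finset.sum_sq_le_sq_sum_of_nonneg fun _ _ => le_max_right _ _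
  have h5 : ∑ i, max (-t i) 0 ^ 2 ≤ (∑ i, max (-t i) 0) ^ 2 :=
    Finset.sum_sq_le_sq_sum_of_nonneg fun _ _ => le_max_right _ _
  have h6 : 0 ≤ ∑ i, max (-t i) 0 := Finset.sum_nonneg fun _ _ => le_max_right _ _
  have h7 : (∑ i, max (t i) 0) ^ 2 ≤ (∑ i, g i) ^ 2 := pow_le_pow_left₀ (by linarith) h3 2
  have h8 : (∑ i, max (-t i) 0) ^ 2 ≤ (∑ i, g i) ^ 2 := pow_le_pow_left₀ h6 (by linarith) 2
  simp only [h1, Finset.sum_add_distrib]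
  linarith

theorem norm2_const {ι : Type*} [Fintype ι] (a : ℝ) :
    norm2 (fun _ : ι => a) = |a| * √(Fintype.card ι) := by
  rw [← Real.sqrt_sq (norm2_nonneg _), norm2_sq]
  simp [Real.sqrt_mul, Real.sqrt_sq_eq_abs, mul_comm]

section Centering
variable {ι : Type*} [Fintype ι] {s μ ds dμ : ι → ℝ} {θ β σ τ : ℝ}

/-- The second-order error of a path-following step stays small. -/
theorem norm2_mul_le_of_newton (hθ : 0 < θ) (hθ' : θ ≤ 0.3) (hβ : 0 < β) (hβθ : β ≤ θ)
    (hσ : 1 - β / √(Fintype.card ι) ≤ σ) (hσ1 : σ < 1) (hσ' : 0.7 ≤ σ) (hτ : 0 < τ)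
    (hc : norm2 (fun i => μ i * s i - τ) ≤ θ * τ)
    (hN : ∀ i, μ i * ds i + s i * dμ i = σ * τ - μ i * s i)
    (hd : 0 ≤ ∑ i, dμ i * ds i) :
    norm2 (fun i => dμ i * ds i) ≤ θ * (σ * τ) := by
  have hlow : ∀ i, (1 - θ) * τ ≤ μ i * s i := by
    intro i
    have := (abs_le.1 ((abs_le_norm2 (fun i => μ i * s i - τ) i).trans hc)).1
    linarith
  have hθτ : 0 < (1 - θ) * τ := mul_pos (by norm_num at hθ'; linarith) hτ
  set h : ι → ℝ := fun i => σ * τ - μ i * s i with hh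
  have hcard : (1 - σ) * √(Fintype.card ι) ≤ β := by
    rcases (Real.sqrt_nonneg (Fintype.card ι : ℝ)).eq_or_lt with h0 | h0
    · rw [← h0]; linarith
    · have : 1 - σ ≤ β / √(Fintype.card ι) := by linarith
      rwa [le_div_iff₀ h0] at this
  -- One `θ * τ` comes from the centrality of the old point, the other from the reduction of `τ`,
  -- since `(1 - σ) * √card ≤ β ≤ θ`.
  have hnorm : norm2 h ≤ 2 * θ * τ := by
    have e : h = (fun _ => -((1 - σ) * τ)) - fun i => μ i * s i - τ := by
      funext i; simp only [hh, Pi.sub_apply]; ring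
    rw [e]
    refine (norm2_sub_le _ _).trans ?_
    rw [norm2_const, abs_neg, abs_of_nonneg (mul_nonneg (by linarith) hτ.le)]
    nlinarith
  -- The majorant comes from `4 (μ ds) (s dμ) ≤ (μ ds + s dμ)² = h²` and `μ s ≥ (1 - θ) τ`.
  have key := sum_sq_le_of_sum_nonneg (t := fun i => dμ i * ds i)
    (g := fun i => h i ^ 2 / (4 * ((1 - θ) * τ))) (fun i => by positivity) (fun i => ?_) hd
  · apply norm2_le_of_sq_le (by positivity)
    refine key.trans ?_
    rw [← Finset.sum_div, ← norm2_sq]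
    -- `3 / 7` is the value of `θ / (1 - θ)` at `θ = 0.3`. The argument closes because `2 * (3 / 7)
    -- ^ 2 ≤ 0.7 ^ 2 ≤ σ ^ 2`.
    have h1 : norm2 h ^ 2 / (4 * ((1 - θ) * τ)) ≤ θ * τ * (3 / 7) := by
      rw [div_le_iff₀ (by positivity)]
      have := pow_le_pow_left₀ (norm2_nonneg h) hnorm 2
      refine this.trans ?_
      have h3 : θ * (θ * τ ^ 2) ≤ (3 * (1 - θ) / 7) * (θ * τ ^ 2) := by
        apply mul_le_mul_of_nonneg_right _ (by positivity)
        norm_num at hθ' ⊢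
        linarith
      linarith
    have h2 := pow_le_pow_left₀ (by positivity) h1 2
    have h3 : (0.7 : ℝ) ^ 2 ≤ σ ^ 2 := pow_le_pow_left₀ (by norm_num) hσ' 2
    have h4 : (0.7 : ℝ) ^ 2 * (θ * τ) ^ 2 ≤ σ ^ 2 * (θ * τ) ^ 2 :=
      mul_le_mul_of_nonneg_right h3 (sq_nonneg _)
    norm_num at h2 h4 ⊢
    nlinarith [sq_nonneg (θ * τ)]
  · rw [le_div_iff₀ (by positivity)]
    have h1 : h i ^ 2 = (μ i * ds i + s i * dμ i) ^ 2 := by rw [hN]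
    rcases le_total (dμ i * ds i) 0 with h0 | h0
    · nlinarith [sq_nonneg (h i)]
    · have := mul_le_mul_of_nonneg_left (hlow i) h0
      nlinarith [sq_nonneg (μ i * ds i - s i * dμ i)]

/-- The product of the new slack and multiplier is `σ τ + dμ ds > 0`, so they have the same sign.
Both cannot be negative, as `μ (s + ds) + s (μ + dμ) = σ τ + μ s > 0`. No continuity argument along
the step is needed. -/
theorem newton_pos (hθ : θ ≤ 0.3) (hσ : 0 < σ) (hτ : 0 < τ)
    (hs : ∀ i, 0 < s i) (hμ : ∀ i, 0 < μ i)
    (hN : ∀ i, μ i * ds i + s i * dμ i = σ * τ - μ i * s i)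
    (hd : norm2 (fun i => dμ i * ds i) ≤ θ * (σ * τ)) (i : ι) :
    0 < s i + ds i ∧ 0 < μ i + dμ i := by
  have hστ : 0 < σ * τ := mul_pos hσ hτ
  have h1 := (abs_le.1 ((abs_le_norm2 (fun i => dμ i * ds i) i).trans hd)).1
  have h2 : 0 < (μ i + dμ i) * (s i + ds i) := by
    have e : (μ i + dμ i) * (s i + ds i) = σ * τ + dμ i * ds i := by linarith [hN i]
    rw [e]
    norm_num at hθ
    nlinarith
  have h3 : 0 < μ i * (s i + ds i) + s i * (μ i + dμ i) := by
    have := mul_pos (hμ i) (hs i)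
    nlinarith [hN i]
  rcases mul_pos_iff.1 h2 with h | h
  · exact ⟨h.2, h.1⟩
  · nlinarith [mul_neg_of_pos_of_neg (hμ i) h.2, mul_neg_of_pos_of_neg (hs i) h.1]

end Centering

/-! ### Exact Newton steps in the neighbourhoods; size and boundary distance of their points. -/

section Path
variable {n m : ℕ} {P : Problem n m} {M : Params} {τ : ℝ} {z w : PD n m}

theorem Params.Admissible.σ_ge' (h : M.Admissible P) (hn : 0 < n) : 0.7 ≤ M.σ := by
  have h1 : (1 : ℝ) ≤ √(2 * n) := by
    rw [Real.one_le_sqrt]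
    have : (1 : ℝ) ≤ n := by exact_mod_cast hn
    linarith
  have h2 : M.β / √(2 * n) ≤ M.β := div_le_self h.β_pos.le h1
  have := h.σ_ge
  have := h.β_le
  have := h.θ_le
  norm_num at *
  linarith

theorem Nbhd.abs_residual_muL (hz : z ∈ Nbhd P M τ) (i : Fin n) :
    |z.muL i * (1 + z.x i) - τ| ≤ M.θ * τ :=
  (abs_le_norm2 (fun s : Fin n ⊕ Fin n => F P M.ω τ z (.inr (.inr s))) (.inl i)).trans hz.2.2.1

theorem Nbhd.abs_residual_muR (hz : z ∈ Nbhd P M τ) (i : Fin n) :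
    |z.muR i * (1 - z.x i) - τ| ≤ M.θ * τ :=
  (abs_le_norm2 (fun s : Fin n ⊕ Fin n => F P M.ω τ z (.inr (.inr s))) (.inr i)).trans hz.2.2.1

/-- An exact Newton step leads from one neighbourhood of the central path to the next. -/
theorem Nbhd.add_mem (h : M.Admissible P) (hn : 0 < n) (hτ : 0 < τ) (hz : z ∈ Nbhd P M τ)
    (hw : (DF P M.ω z).mulVec w = -F P M.ω (M.σ * τ) z) :
    z + w ∈ Nbhd P M (M.σ * τ) := by
  have hσ := h.σ_ge' hn
  have hσ0 : 0 < M.σ := lt_of_lt_of_le (by norm_num) hσ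
  have hF : F P M.ω (M.σ * τ) (z + w) = (1 / 2 : ℝ) • bil w w := by
    rw [F_add, hw]; simp
  -- Both families of bounds are stacked into one complementarity system of `2 n` pairs, which
  -- explains `√(2 * n)` in the rule for `σ`.
  set s : Fin n ⊕ Fin n → ℝ := Sum.elim (fun i => 1 + z.x i) (fun i => 1 - z.x i) with hs
  set μ : Fin n ⊕ Fin n → ℝ := Sum.elim z.muL z.muR with hμ
  set ds : Fin n ⊕ Fin n → ℝ := Sum.elim w.x (fun i => -w.x i) with hds
  set dμ : Fin n ⊕ Fin n → ℝ := Sum.elim w.muL w.muR with hdμ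
  have hr : (fun s : Fin n ⊕ Fin n => F P M.ω (M.σ * τ) (z + w) (.inr (.inr s)))
      = fun i => dμ i * ds i := by
    rw [hF]
    funext i
    rcases i with i | i
    · simp only [Pi.smul_apply, bil, hdμ, hds, Sum.elim_inl, smul_eq_mul]; ring
    · simp only [Pi.smul_apply, bil, hdμ, hds, Sum.elim_inr, smul_eq_mul]; ring
  have hc : norm2 (fun i => μ i * s i - τ) ≤ M.θ * τ := by
    convert hz.2.2.1 using 2
    funext i
    rcases i with i | i <;> rfl
  have hN : ∀ i, μ i * ds i + s i * dμ i = M.σ * τ - μ i * s i := by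
    rintro (i | i)
    · have := congrFun hw (.inr (.inr (.inl i)))
      rw [DF_mulVec_muL, Pi.neg_apply, F] at this
      simp only [hs, hμ, hds, hdμ, Sum.elim_inl]
      linarith
    · have := congrFun hw (.inr (.inr (.inr i)))
      rw [DF_mulVec_muR, Pi.neg_apply, F] at this
      simp only [hs, hμ, hds, hdμ, Sum.elim_inr]
      linarith
  have h1 : ∀ i, w.muL i - w.muR i = (∑ j, P.Q i j * w.x j) + M.ω * w.x i
      - (∑ k, P.A k i * w.lam k) := by
    intro i
    have h1 := congrFun hw (.inl i)
    rw [DF_mulVec_inl, Pi.neg_apply] at h1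
    have h2 : F P M.ω (M.σ * τ) z (.inl i) = 0 := hz.1 i
    linarith
  have h2 : ∀ k, (∑ j, P.A k j * w.x j) = -(M.ω * w.lam k) := by
    intro k
    have h1 := congrFun hw (.inr (.inl k))
    rw [DF_mulVec_lam, Pi.neg_apply] at h1
    have h2 : F P M.ω (M.σ * τ) z (.inr (.inl k)) = 0 := hz.2.1 k
    linarith
  -- By the linear blocks this sum is the quadratic form of `Q + ω I` at `w.x` plus `ω` times the
  -- squared norm of `w.lam`.
  have hd : 0 ≤ ∑ i, dμ i * ds i := by
    have hQ : 0 ≤ ∑ i, w.x i * ∑ j, P.Q i j * w.x j := by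
      have := P.posSemidef_Q.dotProduct_mulVec_nonneg w.x
      simpa [dotProduct, Matrix.mulVec] using this
    have hA : ∑ i, w.x i * ∑ k, P.A k i * w.lam k = ∑ k, w.lam k * ∑ j, P.A k j * w.x j := by
      simp only [Finset.mul_sum]
      rw [Finset.sum_comm]
      exact Finset.sum_congr rfl fun _ _ => Finset.sum_congr rfl fun _ _ => by ring
    have e : ∑ i, dμ i * ds i = ∑ i, w.x i * (∑ j, P.Q i j * w.x j)
        + M.ω * ∑ i, w.x i ^ 2 - ∑ i, w.x i * ∑ k, P.A k i * w.lam k := by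
      rw [Fintype.sum_sum_type, ← Finset.sum_add_distrib, Finset.mul_sum,
        ← Finset.sum_add_distrib, ← Finset.sum_sub_distrib]
      refine Finset.sum_congr rfl fun i _ => ?_
      simp only [hdμ, hds, Sum.elim_inl, Sum.elim_inr]
      linear_combination w.x i * h1 i
    have e' : ∑ k, w.lam k * ∑ j, P.A k j * w.x j = -(M.ω * ∑ k, w.lam k ^ 2) := by
      rw [Finset.mul_sum, ← Finset.sum_neg_distrib]
      refine Finset.sum_congr rfl fun k _ => ?_
      rw [h2]; ring
    rw [e, hA, e']
    have := mul_nonneg h.ω_pos.le (Finset.sum_nonneg fun i (_ : i ∈ Finset.univ) =>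
      sq_nonneg (w.x i))
    have := mul_nonneg h.ω_pos.le (Finset.sum_nonneg fun k (_ : k ∈ Finset.univ) =>
      sq_nonneg (w.lam k))
    linarith
  have hcard : 1 - M.β / √(Fintype.card (Fin n ⊕ Fin n)) ≤ M.σ := by
    have := h.σ_ge
    simpa [two_mul] using this
  have hnorm := norm2_mul_le_of_newton h.θ_pos h.θ_le h.β_pos h.β_le hcard h.σ_lt hσ hτ hc hN hd
  have hpos := newton_pos h.θ_le hσ0 hτ (s := s) (μ := μ)
    (by
      rintro (i | i)
      · have := (abs_lt.1 (hz.2.2.2.1 i)).1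
        simp only [hs, Sum.elim_inl]; linarith
      · have := (abs_lt.1 (hz.2.2.2.1 i)).2
        simp only [hs, Sum.elim_inr]; linarith)
    (by
      rintro (i | i)
      · exact hz.2.2.2.2.1 i
      · exact hz.2.2.2.2.2 i) hN hnorm
  refine ⟨fun i => ?_, fun k => ?_, ?_, fun i => ?_, fun i => ?_, fun i => ?_⟩
  · rw [hF]; simp [bil]
  · rw [hF]; simp [bil]
  · rw [hr]; exact hnorm
  · have hl := (hpos (.inl i)).1
    have hr := (hpos (.inr i)).1
    simp only [hs, hds, Sum.elim_inl, Sum.elim_inr, PD.x] at hl hr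
    rw [abs_lt]
    simp only [PD.x, Pi.add_apply]
    constructor <;> linarith
  · exact (hpos (.inl i)).2
  · exact (hpos (.inr i)).2

theorem Params.Admissible.Clam_nonneg (h : M.Admissible P) : 0 ≤ M.Clam := by
  refine le_trans ?_ h.Clam_ge
  have := h.ω_pos
  have := opNorm_nonneg P.A
  have := norm2_nonneg P.b
  positivity

theorem Params.Admissible.norm2_c_le (h : M.Admissible P) : norm2 P.c ≤ M.CDmu := by
  have := h.CDmu_ge
  have h1 : 0 ≤ (M.ω + opNorm P.Q) * √n :=
    mul_nonneg (add_nonneg h.ω_pos.le (opNorm_nonneg _)) (Real.sqrt_nonneg _)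
  have h2 : 0 ≤ opNorm P.A.transpose * M.Clam := mul_nonneg (opNorm_nonneg _) h.Clam_nonneg
  linarith

theorem Params.Admissible.norm2_b_le (h : M.Admissible P) : norm2 P.b ≤ M.Clam := by
  have h0 := h.ω_pos
  have h1 := h.Clam_ge
  rw [div_le_iff₀ h0] at h1
  have h2 : M.ω ≤ 1 := h.ω_le.trans ((min_le_right _ _).trans (min_le_right _ _))
  have h3 : 0 ≤ opNorm P.A * √n := mul_nonneg (opNorm_nonneg _) (Real.sqrt_nonneg _)
  nlinarith [h.Clam_nonneg]

theorem Params.Admissible.τA_nonneg (h : M.Admissible P) : 0 ≤ M.τA :=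
  le_trans (by have := norm2_nonneg (P.c - (1 / M.ω) • P.A.transpose.mulVec P.b); positivity)
    ((le_max_right _ _).trans h.τA_ge)

theorem Params.Admissible.CDmu_add_le (h : M.Admissible P) (hn : 0 < n) :
    M.CDmu + (1 + M.θ) * M.τA ≤ M.Cmu := by
  refine le_trans (le_mul_of_one_le_left ?_ ?_) h.Cmu_ge
  · have := (norm2_nonneg _).trans h.norm2_c_le
    have := h.τA_nonneg
    have := h.θ_pos
    positivity
  · rw [Real.one_le_sqrt]
    have : (1 : ℝ) ≤ n := by exact_mod_cast hn
    linarith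

theorem Params.Admissible.bounds_le_Cz (h : M.Admissible P) (hn : 0 < n) :
    1 ≤ M.Cz ∧ M.Clam ≤ M.Cz ∧ M.Cmu ≤ M.Cz := by
  have hn' : (1 : ℝ) ≤ n := by exact_mod_cast hn
  have key : ∀ a : ℝ, a ^ 2 ≤ n + M.Clam ^ 2 + M.Cmu ^ 2 → a ≤ M.Cz := by
    intro a ha
    have h1 := Real.le_sqrt_of_sq_le ha
    have h2 := h.Cz_ge
    norm_num at h2
    linarith
  refine ⟨key _ ?_, key _ ?_, key _ ?_⟩ <;> nlinarith [sq_nonneg M.Clam, sq_nonneg M.Cmu]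

/-- The box bounds `x`, the second block then determines `λ`, and the first determines `muL - muR`.
The complementarity equations pass from this difference to the two multipliers separately. -/
theorem Nbhd.norm2_le (h : M.Admissible P) (hn : 0 < n) (hτ : 0 < τ) (hτA : τ ≤ M.τA)
    (hz : z ∈ Nbhd P M τ) : norm2 z ≤ M.Cz - 0.1 := by
  have hn' : (1 : ℝ) ≤ n := by exact_mod_cast hn
  have hω := h.ω_pos
  have hx2 : ∑ i, z.x i ^ 2 ≤ n := by
    calc ∑ i, z.x i ^ 2 ≤ ∑ _i : Fin n, (1 : ℝ) := Finset.sum_le_sum fun i _ => by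
          rw [sq_le_one_iff_abs_le_one]; exact (hz.2.2.2.1 i).le
      _ = n := by simp
  have hx : norm2 z.x ≤ √n := by
    rw [← Real.sqrt_sq (norm2_nonneg _), norm2_sq]
    exact Real.sqrt_le_sqrt hx2
  have hlam : norm2 z.lam ≤ M.Clam := by
    refine le_trans ?_ h.Clam_ge
    rw [le_div_iff₀ hω]
    have e : M.ω • z.lam = P.b - P.A.mulVec z.x := by
      funext k
      have : F P M.ω τ z (.inr (.inl k)) = 0 := hz.2.1 k
      simp only [F] at this
      simp only [Pi.smul_apply, smul_eq_mul, Pi.sub_apply, Matrix.mulVec, dotProduct]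
      linarith
    have h1 := norm2_smul M.ω z.lam
    rw [abs_of_pos hω, e] at h1
    have h2 := norm2_sub_le P.b (P.A.mulVec z.x)
    have h3 := (norm2_mulVec_le P.A z.x).trans (mul_le_mul_of_nonneg_left hx (opNorm_nonneg _))
    linarith
  have hdiff : norm2 (z.muL - z.muR) ≤ M.CDmu := by
    refine le_trans ?_ h.CDmu_ge
    have e : z.muL - z.muR = P.Q.mulVec z.x + M.ω • z.x + P.c - P.A.transpose.mulVec z.lam := by
      funext i
      have : F P M.ω τ z (.inl i) = 0 := hz.1 i
      simp only [F] at this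
      simp only [Pi.smul_apply, smul_eq_mul, Pi.sub_apply, Pi.add_apply, Matrix.mulVec, dotProduct,
        Matrix.transpose_apply]
      linarith
    rw [e]
    have h1 := norm2_sub_le (P.Q.mulVec z.x + M.ω • z.x + P.c) (P.A.transpose.mulVec z.lam)
    have h2 := norm2_add_le (P.Q.mulVec z.x + M.ω • z.x) P.c
    have h3 := norm2_add_le (P.Q.mulVec z.x) (M.ω • z.x)
    have h4 := (norm2_mulVec_le P.Q z.x).trans (mul_le_mul_of_nonneg_left hx (opNorm_nonneg _))
    have h5 := (norm2_mulVec_le P.A.transpose z.lam).trans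
      (mul_le_mul_of_nonneg_left hlam (opNorm_nonneg _))
    have h6 := norm2_smul M.ω z.x
    rw [abs_of_pos hω] at h6
    nlinarith
  set t := (1 + M.θ) * τ with ht
  have ht0 : 0 < t := mul_pos (by linarith [h.θ_pos]) hτ
  have htA : t ≤ (1 + M.θ) * M.τA := mul_le_mul_of_nonneg_left hτA (by linarith [h.θ_pos])
  have hmu : ∑ i, z.muL i ^ 2 + ∑ i, z.muR i ^ 2 ≤ M.Cmu ^ 2 := by
    have h1 : ∀ i, z.muL i ^ 2 + z.muR i ^ 2 ≤ 2 * (|(z.muL - z.muR) i| + t) ^ 2 := by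
      intro i
      have hl := (abs_le.1 (Nbhd.abs_residual_muL hz i)).2
      have hr := (abs_le.1 (Nbhd.abs_residual_muR hz i)).2
      have hl0 := hz.2.2.2.2.1 i
      have hr0 := hz.2.2.2.2.2 i
      have hd := abs_le.1 (le_refl |(z.muL - z.muR) i|)
      simp only [Pi.sub_apply] at hd ⊢
      -- One of the slacks `1 + x`, `1 - x` is at least 1, so its multiplier is at most `t`; the
      -- other differs from it by the known difference.
      have hboth : z.muL i ≤ |z.muL i - z.muR i| + t ∧ z.muR i ≤ |z.muL i - z.muR i| + t := by
        rcases le_total 0 (z.x i) with hx | hx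
        · have : z.muL i ≤ t := by nlinarith
          constructor <;> linarith [abs_nonneg (z.muL i - z.muR i)]
        · have : z.muR i ≤ t := by nlinarith
          constructor <;> linarith [abs_nonneg (z.muL i - z.muR i)]
      have h1 := pow_le_pow_left₀ hl0.le hboth.1 2
      have h2 := pow_le_pow_left₀ hr0.le hboth.2 2
      linarith
    set a : Fin n → ℝ := (fun i => |(z.muL - z.muR) i|) + fun _ => t with ha
    have h2 : norm2 a ≤ M.CDmu + t * √n := by
      refine (norm2_add_le _ _).trans ?_
      rw [norm2_const, abs_of_pos ht0, Fintype.card_fin]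
      have : norm2 (fun i => |(z.muL - z.muR) i|) ≤ 1 * norm2 (z.muL - z.muR) :=
        norm2_le_mul_of_abs_le zero_le_one fun i => by simp
      linarith
    have hs1 : 1 ≤ √(n : ℝ) := by rwa [Real.one_le_sqrt]
    have hCD : 0 ≤ M.CDmu := (norm2_nonneg _).trans h.norm2_c_le
    have h3 : norm2 a ≤ √n * (M.CDmu + (1 + M.θ) * M.τA) := by
      nlinarith
    calc ∑ i, z.muL i ^ 2 + ∑ i, z.muR i ^ 2 ≤ ∑ i, 2 * a i ^ 2 := by
          rw [← Finset.sum_add_distrib]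
          exact Finset.sum_le_sum fun i _ => h1 i
      _ = 2 * norm2 a ^ 2 := by rw [norm2_sq, Finset.mul_sum]
      _ ≤ 2 * (√n * (M.CDmu + (1 + M.θ) * M.τA)) ^ 2 := by
          have := pow_le_pow_left₀ (norm2_nonneg a) h3 2
          linarith
      _ = (√(2 * n) * (M.CDmu + (1 + M.θ) * M.τA)) ^ 2 := by
          rw [mul_pow, mul_pow, Real.sq_sqrt (by positivity), Real.sq_sqrt (by positivity)]
          ring
      _ ≤ M.Cmu ^ 2 := by
          refine pow_le_pow_left₀ ?_ h.Cmu_ge 2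
          refine mul_nonneg (Real.sqrt_nonneg _) ?_
          linarith
  have hl2 : ∑ k, z.lam k ^ 2 ≤ M.Clam ^ 2 := by
    rw [← norm2_sq]; exact pow_le_pow_left₀ (norm2_nonneg _) hlam 2
  have hfin : norm2 z ≤ √(n + M.Clam ^ 2 + M.Cmu ^ 2) := by
    apply Real.le_sqrt_of_sq_le
    rw [norm2_sq_eq]
    linarith
  linarith [h.Cz_ge]

/-- The second claim follows from the first because `τE ≤ τA ≤ Cmu ≤ Cz`. -/
theorem Params.Admissible.gap_facts (h : M.Admissible P) (hn : 0 < n) (hEA : M.τE ≤ M.τA) :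
    2 * M.gap * (1 + M.Cz) ≤ (1 - M.θ) * M.τE ∧ M.gap ≤ 1 := by
  obtain ⟨hz1, -, hz2⟩ := h.bounds_le_Cz hn
  have hτ := h.τE_pos
  have hθ := h.θ_pos
  have hθ' := h.θ_le
  norm_num at hθ'
  have h1 : 2 * M.gap * (1 + M.Cz) ≤ (1 - M.θ) * M.τE := by
    have h2 := h.gap_le
    have e : (1 - M.θ) / (1 + M.Cz) * M.σ * M.τE * (1 / 2)
        = ((1 - M.θ) * M.τE * M.σ) / (2 * (1 + M.Cz)) := by
      field_simp
    rw [e, le_div_iff₀ (by linarith)] at h2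
    have : (1 - M.θ) * M.τE * M.σ ≤ (1 - M.θ) * M.τE * 1 :=
      mul_le_mul_of_nonneg_left h.σ_lt.le (mul_nonneg (by linarith) hτ.le)
    linarith
  refine ⟨h1, ?_⟩
  have h3 := h.CDmu_add_le hn
  have h4 := (norm2_nonneg _).trans h.norm2_c_le
  have h5 : M.τE ≤ M.Cz := by nlinarith
  by_contra! h6
  nlinarith

/-- Slack times multiplier is at least `(1 - θ) τ` while the slack is at most 2 and the multiplier
at most `Cz`, so neither factor can be small. The factor 2 leaves one `gap` for perturbed points. -/
theorem Nbhd.gap_le (h : M.Admissible P) (hn : 0 < n) (hτE : M.τE ≤ τ) (hτA : τ ≤ M.τA)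
    (hz : z ∈ Nbhd P M τ) (i : Fin n) :
    2 * M.gap ≤ 1 + z.x i ∧ 2 * M.gap ≤ 1 - z.x i ∧ 2 * M.gap ≤ z.muL i ∧ 2 * M.gap ≤ z.muR i := by
  have hτ := h.τE_pos.trans_le hτE
  obtain ⟨h1, -⟩ := h.gap_facts hn (hτE.trans hτA)
  obtain ⟨hC1, -⟩ := h.bounds_le_Cz hn
  have hg := h.gap_pos
  have hnorm := Nbhd.norm2_le h hn hτ hτA hz
  norm_num at hnorm
  have hl := (abs_le.1 (Nbhd.abs_residual_muL hz i)).1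
  have hr := (abs_le.1 (Nbhd.abs_residual_muR hz i)).1
  have hl0 := hz.2.2.2.2.1 i
  have hr0 := hz.2.2.2.2.2 i
  have hx := abs_lt.1 (hz.2.2.2.1 i)
  have hL : z.muL i ≤ M.Cz := by
    have := (le_abs_self _).trans (abs_le_norm2 z (.inr (.inr (.inl i))))
    simp only [PD.muL]; linarith
  have hR : z.muR i ≤ M.Cz := by
    have := (le_abs_self _).trans (abs_le_norm2 z (.inr (.inr (.inr i))))
    simp only [PD.muR]; linarith
  have hτ' : (1 - M.θ) * M.τE ≤ (1 - M.θ) * τ := by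
    refine mul_le_mul_of_nonneg_left hτE ?_
    have := h.θ_le; norm_num at this; linarith
  have key : ∀ {a μ : ℝ}, 0 < a → a ≤ 2 → 0 < μ → μ ≤ M.Cz → -(M.θ * τ) ≤ μ * a - τ →
      2 * M.gap ≤ a ∧ 2 * M.gap ≤ μ := by
    intro a μ ha ha2 hμ hμC hp
    have hp' : 2 * M.gap * (1 + M.Cz) ≤ μ * a := by linarith
    constructor
    · by_contra! hlt
      nlinarith
    · by_contra! hlt
      nlinarith
  have k1 := key (by linarith) (by linarith) hl0 hL hl
  have k2 := key (by linarith) (by linarith) hr0 hR hr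
  exact ⟨k1.1, k2.1, k1.2, k2.2⟩

end Path

/-! ### Rounding errors in the evaluation of the residual and the Jacobian. -/

section Rounding
variable {ε : ℝ} {fl : ℝ → ℝ}

theorem IsRounding.abs_le (h : IsRounding ε fl) (hε1 : ε ≤ 1) (t : ℝ) : |fl t| ≤ 2 * |t| := by
  have h1 := h t
  have h2 := abs_sub_abs_le_abs_sub (fl t) t
  nlinarith [abs_nonneg t]

theorem IsRounding.abs_sub_le (h : IsRounding ε fl) (hε : 0 ≤ ε) {t s δ X : ℝ}
    (hts : |t - s| ≤ δ) (ht : |t| ≤ X) : |fl t - s| ≤ ε * X + δ := by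
  have h1 := (h t).trans (mul_le_mul_of_nonneg_left ht hε)
  have h2 := _root_.abs_sub_le (fl t) t s
  linarith

theorem IsRounding.abs_mul_sub_le (h : IsRounding ε fl) (hε : 0 ≤ ε) (hε1 : ε ≤ 1) {a b X : ℝ}
    (hX : |a * b| ≤ X) : |fl (fl a * b) - a * b| ≤ 3 * ε * X ∧ |fl (fl a * b)| ≤ 4 * X := by
  have h1 : |fl a * b| ≤ 2 * X := by
    rw [abs_mul] at hX ⊢
    have := mul_le_mul_of_nonneg_right (h.abs_le hε1 a) (abs_nonneg b)
    linarith
  have h2 : |fl a * b - a * b| ≤ ε * X := by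
    rw [← sub_mul, abs_mul]
    rw [abs_mul] at hX
    have h1 := mul_le_mul_of_nonneg_right (h a) (abs_nonneg b)
    have h2 := mul_le_mul_of_nonneg_left hX hε
    linarith
  constructor
  · have := h.abs_sub_le hε h2 h1
    linarith
  · have := h.abs_le hε1 (fl a * b)
    linarith

theorem FlSum.card_pos {s : Multiset ℝ} {r : ℝ} (h : FlSum fl s r) : 1 ≤ s.card := by
  induction h with
  | single t => simp
  | add _ _ h1 h2 => rw [Multiset.card_add]; omega

/-- Error bound for summation in an arbitrary order. -/
theorem FlSum.abs_sub_sum_le (hfl : IsRounding ε fl) (hε : 0 ≤ ε) (hε1 : ε ≤ 1)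
    {s : Multiset ℝ} {r : ℝ} (h : FlSum fl s r) :
    |r - s.sum| ≤ ε * (2 ^ s.card - 1) * (s.map fun t => |t|).sum := by
  induction h with
  | single t =>
    simp only [Multiset.sum_singleton, sub_self, abs_zero, Multiset.card_singleton,
      Multiset.map_singleton]
    norm_num
    positivity
  | @add s₁ s₂ r₁ r₂ h1 h2 ih1 ih2 =>
    rw [Multiset.sum_add, Multiset.map_add, Multiset.sum_add, Multiset.card_add]
    set S₁ := (s₁.map fun t => |t|).sum
    set S₂ := (s₂.map fun t => |t|).sum
    have a1 : |s₁.sum| ≤ S₁ := Multiset.abs_sum_le_sum_abs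
    have a2 : |s₂.sum| ≤ S₂ := Multiset.abs_sum_le_sum_abs
    -- Both summands are nonempty, so each has at least one term fewer than the whole and `g` serves
    -- for either. The last addition turns `g` into `1 + 2 * g`, the terms in `ε ^ 2` being absorbed
    -- by `ε ≤ 1`.
    set g : ℝ := 2 ^ (s₁.card + s₂.card - 1) - 1 with hg
    have hg0 : 0 ≤ g := by
      have : (1 : ℝ) ≤ 2 ^ (s₁.card + s₂.card - 1) := one_le_pow₀ (by norm_num)
      linarith
    have hpow : (2 : ℝ) ^ (s₁.card + s₂.card) - 1 = 1 + 2 * g := by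
      have := h1.card_pos
      obtain ⟨k, hk⟩ : ∃ k, s₁.card + s₂.card = k + 1 := ⟨s₁.card + s₂.card - 1, by omega⟩
      rw [hg, hk, Nat.add_sub_cancel, pow_succ]; ring
    have hS1 : 0 ≤ S₁ := (abs_nonneg _).trans a1
    have hS2 : 0 ≤ S₂ := (abs_nonneg _).trans a2
    have i1 : |r₁ - s₁.sum| ≤ ε * g * S₁ := by
      refine ih1.trans ?_
      have : (2 : ℝ) ^ s₁.card - 1 ≤ g := sub_le_sub_right (
        pow_le_pow_right₀ (by norm_num) (by have := h2.card_pos; omega)) _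
      gcongr
    have i2 : |r₂ - s₂.sum| ≤ ε * g * S₂ := by
      refine ih2.trans ?_
      have : (2 : ℝ) ^ s₂.card - 1 ≤ g := sub_le_sub_right (
        pow_le_pow_right₀ (by norm_num) (by have := h1.card_pos; omega)) _
      gcongr
    have i3 : |(r₁ + r₂) - (s₁.sum + s₂.sum)| ≤ ε * g * (S₁ + S₂) := by
      have := abs_add_le (r₁ - s₁.sum) (r₂ - s₂.sum)
      rw [show (r₁ + r₂) - (s₁.sum + s₂.sum) = (r₁ - s₁.sum) + (r₂ - s₂.sum) by ring]
      linarith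
    have i4 : |r₁ + r₂| ≤ (1 + ε * g) * (S₁ + S₂) := by
      have h3 := abs_sub_abs_le_abs_sub (r₁ + r₂) (s₁.sum + s₂.sum)
      have h4 := abs_add_le s₁.sum s₂.sum
      linarith
    refine (hfl.abs_sub_le hε i3 i4).trans ?_
    rw [hpow]
    have : ε * (ε * g * (S₁ + S₂)) ≤ 1 * (ε * g * (S₁ + S₂)) :=
      mul_le_mul_of_nonneg_right hε1 (by positivity)
    linarith

theorem FlSum.abs_sub_sum_le_card (hfl : IsRounding ε fl) (hε : 0 ≤ ε) (hε1 : ε ≤ 1)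
    {s : Multiset ℝ} {r Y : ℝ} (h : FlSum fl s r) (hY : ∀ t ∈ s, |t| ≤ Y) :
    |r - s.sum| ≤ ε * 2 ^ s.card * (s.card * Y) := by
  have h1 : (s.map fun t => |t|).sum ≤ s.card * Y := by
    have := Multiset.sum_le_card_nsmul (s.map fun t => |t|) Y (by simpa using hY)
    simpa using this
  have h0 : 0 ≤ (s.map fun t => |t|).sum := by
    apply Multiset.sum_nonneg
    simp only [Multiset.mem_map]
    rintro _ ⟨t, -, rfl⟩
    exact abs_nonneg t
  refine (h.abs_sub_sum_le hfl hε hε1).trans ?_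
  have : (1 : ℝ) ≤ 2 ^ s.card := one_le_pow₀ (by norm_num)
  gcongr
  linarith

theorem abs_sum_sub_sum_le {ι : Type*} [Fintype ι] {f g : ι → ℝ} {δ : ℝ}
    (h : ∀ i, |f i - g i| ≤ δ) : |∑ i, f i - ∑ i, g i| ≤ Fintype.card ι * δ := by
  rw [← Finset.sum_sub_distrib]
  refine (Finset.abs_sum_le_sum_abs _ _).trans ((Finset.sum_le_sum fun i _ => h i).trans ?_)
  simp

variable {n m : ℕ} {P : Problem n m} {ω τ Z D : ℝ} {z r : PD n m}

/-- The 3 is due to the diagonal entries `Q i i + ω`, where two stored numbers are added; every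
other entry is rounded at most once. -/
theorem computedDF_sub_le (hfl : IsRounding ε fl) (hε : 0 ≤ ε) (hε1 : ε ≤ 1) (hω : 0 ≤ ω)
    (hQ : ∀ i j, |P.Q i j| + ω ≤ D) (hA : ∀ k j, |P.A k j| ≤ D) (hωD : ω ≤ D)
    (hD : 1 + Z ≤ D) (hz : ∀ s, |z s| ≤ Z) (s t : Idx n m) :
    |(computedDF fl P ω z - DF P ω z) s t| ≤ 3 * ε * D := by
  have hD0 : 0 ≤ D := hω.trans hωD
  have h0 : 0 ≤ 3 * ε * D := by positivity
  have hmul : ∀ {a : ℝ}, |a| ≤ D → |fl a - a| ≤ 3 * ε * D := by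
    intro a ha
    have := hfl.abs_sub_le hε (t := a) (s := a) (δ := 0) (by simp) ha
    nlinarith
  have hQ' : ∀ i j, |P.Q i j| ≤ D := fun i j => by linarith [hQ i j]
  have hωD' : |ω| ≤ D := by rwa [abs_of_nonneg hω]
  rw [Matrix.sub_apply]
  rcases s with i | k | i | i <;> rcases t with j | l | j | j <;>
    simp only [computedDF, DF, sub_self, abs_zero, h0]
  · split_ifs with hij
    · have h1 : |(fl (P.Q i j) + fl ω) - (P.Q i j + ω)| ≤ ε * D := by
        have h1 := hfl (P.Q i j)
        have h2 := hfl ω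
        rw [abs_of_nonneg hω] at h2
        have h3 := abs_add_le (fl (P.Q i j) - P.Q i j) (fl ω - ω)
        have h4 := mul_le_mul_of_nonneg_left (hQ i j) hε
        rw [show (fl (P.Q i j) + fl ω) - (P.Q i j + ω)
          = (fl (P.Q i j) - P.Q i j) + (fl ω - ω) by ring]
        linarith
      have h2 : |fl (P.Q i j) + fl ω| ≤ 2 * D := by
        have h1 := hfl.abs_le hε1 (P.Q i j)
        have h2 := hfl.abs_le hε1 ω
        rw [abs_of_nonneg hω] at h2
        have h3 := abs_add_le (fl (P.Q i j)) (fl ω)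
        linarith [hQ i j]
      have := hfl.abs_sub_le hε h1 h2
      linarith
    · exact hmul (hQ' i j)
  · rw [show -fl (P.A l i) - -P.A l i = -(fl (P.A l i) - P.A l i) by ring, abs_neg]
    exact hmul (hA l i)
  · exact hmul (hA k j)
  · split_ifs
    · exact hmul hωD'
    · simpa using h0
  · split_ifs
    · apply hmul
      have := abs_add_le 1 (z.x i)
      have := hz (.inl i)
      simp only [PD.x, abs_one] at *
      linarith
    · simpa using h0
  · split_ifs
    · apply hmul
      have := abs_sub 1 (z.x i)
      have := hz (.inl i)
      simp only [PD.x, abs_one] at *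
      linarith
    · simpa using h0

theorem abs_DF_le (hω : 0 ≤ ω)
    (hQ : ∀ i j, |P.Q i j| + ω ≤ D) (hA : ∀ k j, |P.A k j| ≤ D) (hωD : ω ≤ D)
    (hD : 1 + Z ≤ D) (hZ : 0 ≤ Z) (hz : ∀ s, |z s| ≤ Z) (s t : Idx n m) :
    |DF P ω z s t| ≤ D := by
  have hD0 : 0 ≤ D := hω.trans hωD
  have hD1 : 1 ≤ D := by linarith
  have hQ' : ∀ i j, |P.Q i j| ≤ D := fun i j => by linarith [hQ i j]
  have hωD' : |ω| ≤ D := by rwa [abs_of_nonneg hω]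
  have hz' : ∀ s, |z s| ≤ D := fun s => by linarith [hz s]
  rcases s with i | k | i | i <;> rcases t with j | l | j | j <;>
    simp only [DF, abs_zero, hD0, abs_neg, hA]
  all_goals split_ifs
  all_goals try simp only [abs_zero, abs_neg, abs_one, hD0, hD1, hQ', hωD']
  · have := abs_add_le (P.Q i j) ω
    rw [abs_of_nonneg hω] at this
    linarith [hQ i j]
  · exact hz' _
  · have := abs_add_le 1 (z.x i)
    have := hz (.inl i)
    simp only [PD.x, abs_one] at *
    linarith
  · exact hz' _
  · have := abs_sub 1 (z.x i)
    have := hz (.inl i)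
    simp only [PD.x, abs_one] at *
    linarith

theorem IsRounding.abs_residual_sub_le (hfl : IsRounding ε fl) (hε : 0 ≤ ε) (hε1 : ε ≤ 1)
    {μ a X : ℝ} (hp : |μ| * |a| ≤ X) (hτ : |τ| ≤ X) :
    |fl (fl (μ * fl a) - fl τ) - (μ * a - τ)| ≤ 10 * ε * X := by
  have hp' : |a * μ| ≤ X := by rwa [abs_mul, mul_comm]
  have h1 := hfl.abs_mul_sub_le hε hε1 hp'
  rw [mul_comm (fl a), mul_comm a] at h1
  have h2 := (hfl τ).trans (mul_le_mul_of_nonneg_left hτ hε)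
  have h3 := (hfl.abs_le hε1 τ).trans (mul_le_mul_of_nonneg_left hτ zero_le_two)
  have h4 : |(fl (μ * fl a) - fl τ) - (μ * a - τ)| ≤ 4 * ε * X := by
    rw [show (fl (μ * fl a) - fl τ) - (μ * a - τ)
      = (fl (μ * fl a) - μ * a) - (fl τ - τ) by ring]
    have := abs_sub (fl (μ * fl a) - μ * a) (fl τ - τ)
    linarith
  have h5 : |fl (μ * fl a) - fl τ| ≤ 6 * X := by
    have := abs_sub (fl (μ * fl a)) (fl τ)
    linarith
  have := hfl.abs_sub_le hε h4 h5
  linarith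

/-- The longest sum has `n + m + 4` terms of computed size at most `4 * (D * Z)`, each with error at
most `3 * ε * (D * Z)`; this yields the constant. The scale `D * Z`, matrix size times vector size,
is what the solver estimate accepts as a relative perturbation. -/
theorem IsComputedF.abs_sub_le (hfl : IsRounding ε fl) (hε : 0 ≤ ε) (hε1 : ε ≤ 1)
    (h : IsComputedF fl P ω τ z r) (hω : 0 ≤ ω) (hZ : 0 ≤ Z)
    (hQ : ∀ i j, |P.Q i j| ≤ D) (hA : ∀ k j, |P.A k j| ≤ D) (hωD : ω ≤ D)
    (hD : 1 + Z ≤ D) (hz : ∀ s, |z s| ≤ Z) (hc : ∀ i, |P.c i| ≤ Z) (hb : ∀ k, |P.b k| ≤ Z)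
    (hτ : |τ| ≤ Z) (s : Idx n m) :
    |r s - F P ω τ z s| ≤ (2 ^ (n + m + 4) * 4 + 3) * (n + m + 4) * ε * (D * Z) := by
  have hD0 : 0 ≤ D := hω.trans hωD
  set X := D * Z with hX
  have hX0 : 0 ≤ X := mul_nonneg hD0 hZ
  have hεX : 0 ≤ ε * X := by positivity
  have hZX : Z ≤ X := by rw [hX]; nlinarith
  have hp : ∀ {a : ℝ} (s : Idx n m), |a| ≤ D → |a * z s| ≤ X := by
    intro a s ha
    rw [abs_mul]
    exact mul_le_mul ha (hz s) (abs_nonneg _) hD0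
  have hp1 : ∀ {a : ℝ} (s : Idx n m), |a| ≤ D →
      |fl (fl a * z s) - a * z s| ≤ 3 * ε * X :=
    fun s ha => (hfl.abs_mul_sub_le hε hε1 (hp s ha)).1
  have hp2 : ∀ {a : ℝ} (s : Idx n m), |a| ≤ D → |fl (fl a * z s)| ≤ 4 * X :=
    fun s ha => (hfl.abs_mul_sub_le hε hε1 (hp s ha)).2
  have hq1 : ∀ {a : ℝ}, |a| ≤ Z → |fl a - a| ≤ 3 * ε * X := by
    intro a ha
    have := (hfl a).trans (mul_le_mul_of_nonneg_left (ha.trans hZX) hε)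
    linarith
  have hq2 : ∀ {a : ℝ}, |a| ≤ Z → |fl a| ≤ 4 * X := by
    intro a ha
    have := hfl.abs_le hε1 a
    linarith
  have hz4 : ∀ s, |z s| ≤ 4 * X := fun s => by linarith [hz s]
  have hωD' : |ω| ≤ D := by rwa [abs_of_nonneg hω]
  have hpow : (1 : ℝ) ≤ 2 ^ (n + m + 4) := one_le_pow₀ (by norm_num)
  have hn : (0 : ℝ) ≤ n := n.cast_nonneg
  have hm : (0 : ℝ) ≤ m := m.cast_nonneg
  have hlast : 10 * ε * X ≤ (2 ^ (n + m + 4) * 4 + 3) * (n + m + 4) * ε * X := by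
    have : (10 : ℝ) ≤ (2 ^ (n + m + 4) * 4 + 3) * (n + m + 4) := by nlinarith
    nlinarith
  rcases s with i | k | i | i
  · have h1 := (h.first i).abs_sub_sum_le_card hfl hε hε1 (Y := 4 * X) ?_
    · simp only [Multiset.card_add, Multiset.card_map, Finset.card_val, Finset.card_univ,
        Fintype.card_fin, Multiset.card_singleton, Multiset.sum_add, Multiset.sum_singleton,
        Finset.sum_map_val, show n + 1 + 1 + m + 1 + 1 = n + m + 4 by ring] at h1
      have e1 := abs_sum_sub_sum_le (f := fun j => fl (fl (P.Q i j) * z.x j))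
        (g := fun j => P.Q i j * z.x j) fun j => hp1 _ (hQ i j)
      have e2 := abs_sum_sub_sum_le (f := fun k => -fl (fl (P.A k i) * z.lam k))
        (g := fun k => -(P.A k i * z.lam k)) (δ := 3 * ε * X) fun k => by
          rw [neg_sub_neg, abs_sub_comm]; exact hp1 _ (hA k i)
      have e3 : |fl (fl ω * z.x i) - ω * z.x i| ≤ 3 * ε * X := hp1 _ hωD'
      have e4 := hq1 (hc i)
      rw [Fintype.card_fin] at e1 e2
      simp only [Finset.sum_neg_distrib] at e2 h1
      push_cast at h1
      rw [abs_le] at *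
      simp only [F]
      constructor <;> nlinarith
    · intro t ht
      simp only [Multiset.mem_add, Multiset.mem_map, Finset.mem_val, Finset.mem_univ, true_and,
        Multiset.mem_singleton] at ht
      rcases ht with ((((⟨j, rfl⟩ | rfl) | rfl) | ⟨k, rfl⟩) | rfl) | rfl
      · exact hp2 _ (hQ i j)
      · exact hp2 _ hωD'
      · exact hq2 (hc i)
      · rw [abs_neg]; exact hp2 _ (hA k i)
      · rw [abs_neg]; exact hz4 _
      · exact hz4 _
  · have h1 := (h.second k).abs_sub_sum_le_card hfl hε hε1 (Y := 4 * X) ?_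
    · simp only [Multiset.card_add, Multiset.card_map, Finset.card_val, Finset.card_univ,
        Fintype.card_fin, Multiset.card_singleton, Multiset.sum_add, Multiset.sum_singleton,
        Finset.sum_map_val] at h1
      have h2 : ε * 2 ^ (n + 1 + 1) * (((n + 1 + 1 : ℕ) : ℝ) * (4 * X))
          ≤ ε * 2 ^ (n + m + 4) * ((n + m + 4) * (4 * X)) := by
        have h2 : (2 : ℝ) ^ (n + 1 + 1) ≤ 2 ^ (n + m + 4) :=
          pow_le_pow_right₀ (by norm_num) (by omega)
        have h3 : ((n + 1 + 1 : ℕ) : ℝ) ≤ n + m + 4 := by push_cast; linarith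
        gcongr
      have e1 := abs_sum_sub_sum_le (f := fun j => fl (fl (P.A k j) * z.x j))
        (g := fun j => P.A k j * z.x j) fun j => hp1 _ (hA k j)
      have e3 : |fl (fl ω * z.lam k) - ω * z.lam k| ≤ 3 * ε * X := hp1 _ hωD'
      have e4 := hq1 (hb k)
      rw [Fintype.card_fin] at e1
      have h1 := h1.trans h2
      rw [abs_le] at *
      simp only [F]
      have : 0 ≤ m * (ε * X) := by positivity
      constructor <;> nlinarith
    · intro t ht
      simp only [Multiset.mem_add, Multiset.mem_map, Finset.mem_val, Finset.mem_univ, true_and,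
        Multiset.mem_singleton] at ht
      rcases ht with (⟨j, rfl⟩ | rfl) | rfl
      · exact hp2 _ (hA k j)
      · rw [abs_neg]; exact hq2 (hb k)
      · exact hp2 _ hωD'
  · rw [h.third, F]
    refine le_trans (hfl.abs_residual_sub_le hε hε1 ?_ (hτ.trans hZX)) hlast
    have h1 := abs_add_le 1 (z.x i)
    have h2 := hz (.inl i)
    have h3 : |1 + z.x i| ≤ D := by
      simp only [PD.x, abs_one] at *
      linarith
    rw [hX, mul_comm D]
    exact mul_le_mul (hz _) h3 (abs_nonneg _) hZ
  · rw [h.fourth, F]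
    refine le_trans (hfl.abs_residual_sub_le hε hε1 ?_ (hτ.trans hZX)) hlast
    have h1 := abs_sub 1 (z.x i)
    have h2 := hz (.inl i)
    have h3 : |1 - z.x i| ≤ D := by
      simp only [PD.x, abs_one] at *
      linarith
    rw [hX, mul_comm D]
    exact mul_le_mul (hz _) h3 (abs_nonneg _) hZ

end Rounding

/-! ### Perturbation theory for the stable solver. -/

/-- A stable solver, applied to perturbed data, solves the unperturbed system up to an error
proportional to the condition number. -/
theorem IsStableSolver.norm2_solve_sub_le {ι : Type*} [Fintype ι] [DecidableEq ι] {C ε : ℝ}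
    {solve : Matrix ι ι ℝ → (ι → ℝ) → (ι → ℝ)} (hs : IsStableSolver C ε solve) (hC : 0 ≤ C)
    (hε : 0 ≤ ε) (hε1 : ε ≤ 1) {G₀ G : Matrix ι ι ℝ} {v w : ι → ℝ} {a B D κ Z : ℝ}
    (ha : 1 ≤ a) (hB : 0 ≤ B) (hD : 0 ≤ D) (hZ : 0 ≤ Z) (hκ : D * B ≤ κ) (hκ1 : 1 ≤ κ)
    (hsmall : 16 * (C + 1) * a * (ε * κ) ≤ 1)
    (hinv : ∀ u, norm2 u ≤ B * norm2 (G₀.mulVec u))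
    (hG₀ : ∀ u, norm2 (G₀.mulVec u) ≤ a * D * norm2 u)
    (hG : ∀ u, norm2 ((G - G₀).mulVec u) ≤ a * ε * D * norm2 u)
    (hv : norm2 (v - G₀.mulVec w) ≤ a * ε * D * Z) (hw : norm2 w ≤ a * Z) :
    norm2 (solve G v - w) ≤ 10 * (C + 1) * a ^ 2 * (ε * κ) * Z := by
  set η := ε * κ with hη
  have hη0 : 0 ≤ η := by positivity
  have hεDB : ε * D * B ≤ η := by
    rw [hη, mul_assoc]; exact mul_le_mul_of_nonneg_left hκ hε
  have hεη : ε ≤ η := le_mul_of_one_le_right hε hκ1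
  have haη : 16 * (a * η) ≤ 1 := by
    have : 0 ≤ C * (a * η) := by positivity
    linarith
  have hCaη : 16 * (C * (a * η)) ≤ 1 := by
    have : 0 ≤ a * η := by positivity
    linarith
  -- The perturbation `G - G₀` consumes at most half of the lower bound for `G₀`; this makes `G`
  -- regular and admissible for the solver.
  have hinvG : ∀ u, norm2 u ≤ 2 * B * norm2 (G.mulVec u) := by
    intro u
    have h1 := hinv u
    have h2 := hG u
    have h3 : norm2 (G₀.mulVec u) ≤ norm2 (G.mulVec u) + norm2 ((G - G₀).mulVec u) := by
      have := norm2_sub_le (G.mulVec u) ((G - G₀).mulVec u)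
      rwa [← Matrix.sub_mulVec, sub_sub_cancel] at this
    have h4 : norm2 ((G - G₀).mulVec u) ≤ 1 / 2 * norm2 (G₀.mulVec u) := by
      calc norm2 ((G - G₀).mulVec u) ≤ a * ε * D * norm2 u := h2
        _ ≤ a * ε * D * (B * norm2 (G₀.mulVec u)) := by gcongr
        _ = a * (ε * D * B) * norm2 (G₀.mulVec u) := by ring
        _ ≤ a * η * norm2 (G₀.mulVec u) := by
            have := norm2_nonneg (G₀.mulVec u)
            gcongr
        _ ≤ 1 / 2 * norm2 (G₀.mulVec u) := by
            have := norm2_nonneg (G₀.mulVec u)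
            gcongr
            linarith
    nlinarith
  have hGle : opNorm G ≤ 2 * a * D := by
    refine opNorm_le_of_forall (by positivity) fun u => ?_
    have h1 := norm2_add_le (G₀.mulVec u) ((G - G₀).mulVec u)
    rw [← Matrix.add_mulVec, add_sub_cancel] at h1
    have h2 : a * ε * D * norm2 u ≤ a * 1 * D * norm2 u := by
      have := norm2_nonneg u
      gcongr
    linarith [hG₀ u, hG u]
  have hGinv := opNorm_inv_le (by positivity) hinvG
  have hcond : C * ε * (opNorm G * opNorm G⁻¹) < 1 := by
    calc C * ε * (opNorm G * opNorm G⁻¹) ≤ C * ε * (2 * a * D * (2 * B)) := by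
          have := opNorm_nonneg G⁻¹
          gcongr
      _ = 4 * C * a * (ε * D * B) := by ring
      _ ≤ 4 * C * a * η := by gcongr
      _ < 1 := by linarith
  obtain ⟨δG, δv, u, hδG, hδv, hu, hsu⟩ := hs G v (isUnit_det_of_norm2_le hinvG) hcond
  have hvn : norm2 v ≤ 2 * a ^ 2 * D * Z := by
    have h1 := norm2_add_le (v - G₀.mulVec w) (G₀.mulVec w)
    rw [sub_add_cancel] at h1
    have h2 : norm2 (G₀.mulVec w) ≤ a * D * (a * Z) :=
      (hG₀ w).trans (mul_le_mul_of_nonneg_left hw (by positivity))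
    have h3 : a * ε * D * Z ≤ a * a * D * Z := by
      have : ε ≤ a := hε1.trans ha
      gcongr
    linarith
  have heq : G₀.mulVec (u - w) = (v - G₀.mulVec w) + δv - ((G - G₀).mulVec u + δG.mulVec u) := by
    rw [Matrix.add_mulVec] at hu
    rw [Matrix.mulVec_sub, Matrix.sub_mulVec]
    have : v + δv = G.mulVec u + δG.mulVec u := hu.symm
    rw [show v - G₀.mulVec w + δv = (v + δv) - G₀.mulVec w by abel, this]
    abel
  have hbound : norm2 (G₀.mulVec (u - w)) ≤
      ε * D * (2 * (C + 1) * a ^ 2 * Z + 2 * (C + 1) * a * norm2 u) := by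
    rw [heq]
    have h1 := norm2_sub_le (v - G₀.mulVec w + δv) ((G - G₀).mulVec u + δG.mulVec u)
    have h2 := norm2_add_le (v - G₀.mulVec w) δv
    have h3 := norm2_add_le ((G - G₀).mulVec u) (δG.mulVec u)
    have h4 : norm2 (δG.mulVec u) ≤ C * ε * (2 * a * D) * norm2 u :=
      (norm2_mulVec_le δG u).trans (mul_le_mul_of_nonneg_right
        (hδG.trans (mul_le_mul_of_nonneg_left hGle (by positivity))) (norm2_nonneg u))
    have h5 : norm2 δv ≤ C * ε * (2 * a ^ 2 * D * Z) :=
      hδv.trans (mul_le_mul_of_nonneg_left hvn (by positivity))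
    have h6 : a * ε * D * Z ≤ 2 * a ^ 2 * ε * D * Z := by
      gcongr
      nlinarith
    have h7 : 0 ≤ a * ε * D * norm2 u := by have := norm2_nonneg u; positivity
    linarith [hG u]
  have hun := norm2_nonneg u
  have huw : norm2 (u - w) ≤ η * (2 * (C + 1) * a ^ 2 * Z + 2 * (C + 1) * a * norm2 u) := by
    calc norm2 (u - w) ≤ B * norm2 (G₀.mulVec (u - w)) := hinv _
      _ ≤ B * (ε * D * (2 * (C + 1) * a ^ 2 * Z + 2 * (C + 1) * a * norm2 u)) := by gcongr
      _ = ε * D * B * (2 * (C + 1) * a ^ 2 * Z + 2 * (C + 1) * a * norm2 u) := by ring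
      _ ≤ _ := by gcongr
  have hu1 : norm2 u ≤ norm2 (u - w) + a * Z := by
    have := norm2_add_le (u - w) w
    rw [sub_add_cancel] at this
    linarith
  have ht0 : 0 ≤ (C + 1) * a * η := by positivity
  have ht1 : 16 * ((C + 1) * a * η) ≤ 1 := by linarith
  -- `norm2 u` on the right of `huw` is replaced by `norm2 (u - w) + a * Z`, and the small multiple
  -- of `norm2 (u - w)` is absorbed on the left.
  have hmain : norm2 (u - w) ≤ 8 * ((C + 1) * a * η) * (a * Z) := by
    have h1 : (C + 1) * a * η * norm2 u ≤ (C + 1) * a * η * (norm2 (u - w) + a * Z) :=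
      mul_le_mul_of_nonneg_left hu1 ht0
    have h2 : 16 * ((C + 1) * a * η) * norm2 (u - w) ≤ 1 * norm2 (u - w) :=
      mul_le_mul_of_nonneg_right ht1 (norm2_nonneg _)
    have h3 : 0 ≤ (C + 1) * a * η * (a * Z) := by positivity
    linarith
  have hu2 : norm2 u ≤ 2 * (a * Z) := by
    have h2 : 16 * ((C + 1) * a * η) * (a * Z) ≤ 1 * (a * Z) :=
      mul_le_mul_of_nonneg_right ht1 (by positivity)
    have : 0 ≤ a * Z := by positivity
    linarith
  have hfin : norm2 (solve G v - u) ≤ 2 * ((C + 1) * a * η) * (a * Z) := by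
    calc norm2 (solve G v - u) ≤ C * ε * norm2 u := hsu
      _ ≤ (C + 1) * (a * η) * (2 * (a * Z)) := by
          have : ε ≤ a * η := hεη.trans (le_mul_of_one_le_left hη0 ha)
          gcongr
          linarith
      _ = _ := by ring
  have := norm2_add_le (solve G v - u) (u - w)
  rw [sub_add_sub_cancel] at this
  linarith

/-! ### The parameter rules at work: conditioning and the inexact starting point. -/

section Main
variable {n m : ℕ} {P : Problem n m} {M : Params} {τ : ℝ} {z z₀ : PD n m}

theorem Params.Admissible.cond_facts (h : M.Admissible P) (hn : 0 < n) (hEA : M.τE ≤ M.τA) :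
    1 / M.ω ≤ M.gap * M.CDFinv ∧ M.Cz / M.gap ≤ M.gap * M.CDFinv ∧ 1 ≤ M.CDFinv ∧
      4 + 4 * M.Cz ≤ M.CDF ∧ 1 ≤ M.κDF := by
  have hg := h.gap_pos
  have hg1 := (h.gap_facts hn hEA).2
  have hω := h.ω_pos
  have hω1 : M.ω ≤ 1 := h.ω_le.trans ((min_le_right _ _).trans (min_le_right _ _))
  have h1 := h.CDFinv_ge
  rw [one_div_mul_eq_div, div_le_iff₀' hg] at h1
  have h2 := (le_max_left _ _).trans h1
  have h3 := (le_max_right _ _).trans h1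
  have h4 : 1 ≤ 1 / M.ω := by rw [le_div_iff₀ hω]; linarith
  have h5 : 1 ≤ M.CDFinv := by nlinarith
  have h6 : 4 + 4 * M.Cz ≤ M.CDF := by
    have h1 := h.CDF_ge
    have h2 := opNorm_nonneg P.Q
    have h3 : 0 ≤ frobNorm P.A := Real.sqrt_nonneg _
    linarith
  have h7 := (h.bounds_le_Cz hn).1
  refine ⟨h2, h3, h5, h6, ?_⟩
  have := h.κDF_ge
  nlinarith

/-- All follows from `4 * CDFinv * CDF ≤ Cν`: the first bound in the rule for `Cν` contains `2 *
CdDz ≥ 4 * κDF ≥ 4`. -/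
theorem Params.Admissible.radius_facts (h : M.Admissible P) (hn : 0 < n) (hEA : M.τE ≤ M.τA) :
    M.ν0 ≤ M.gap ∧ M.ν0 ≤ 0.1 ∧ M.ν1 ≤ 0.1 ∧ 4 * M.CDFinv * M.CDF * M.ν0 ≤ M.ν1 ∧
      4 * M.ν0 ≤ M.ν1 := by
  obtain ⟨-, -, h3, h4, h5⟩ := h.cond_facts hn hEA
  have hCz := (h.bounds_le_Cz hn).1
  have hκ := h.κDF_ge
  have hCν : 4 * (M.CDFinv * M.CDF) ≤ M.Cν := by
    refine le_trans ?_ ((le_max_left _ _).trans h.Cν_ge)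
    have a1 := h.CdDz_ge
    have a2 := h.CdF_ge
    have a3 := h.CdDF_ge
    have a4 := h.ω_pos
    have a5 : 0 ≤ 2 / M.ω * M.CdDF * M.Cz := by positivity
    have a6 : M.CDF * M.CDFinv ≤ M.CdF * M.CDFinv :=
      mul_le_mul_of_nonneg_right a2 (by linarith)
    have a7 : (2 * 2) * (M.CDF * M.CDFinv) ≤
        2 * M.CdDz * (M.CdF * M.CDFinv + 2 / M.ω * M.CdDF * M.Cz) := by
      have : 0 ≤ M.CDF * M.CDFinv := mul_nonneg (by linarith) (by linarith)
      apply mul_le_mul _ _ this _ <;> linarith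
    linarith
  have hprod : 1 ≤ M.CDFinv * M.CDF := by nlinarith
  have hCν1 : 1 ≤ M.Cν := by linarith
  have hν0 := h.ν0_pos
  have hν1 := h.ν1_pos
  have hν2 := h.ν2_pos
  have b1 := h.ν0_le
  rw [le_div_iff₀ (by linarith)] at b1
  have b2 := h.ν1_le
  rw [le_div_iff₀ (by linarith)] at b2
  have b3 : M.ν0 ≤ M.ν1 := by nlinarith
  have b4 : M.ν1 ≤ M.ν2 := by nlinarith
  have b5 : M.ν2 ≤ 0.1 := h.ν2_le.trans ((min_le_left _ _).trans (min_le_left _ _))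
  have b6 : M.ν2 ≤ M.gap :=
    (h.ν2_le.trans ((min_le_left _ _).trans (min_le_right _ _))).trans
      (div_le_self h.gap_pos.le hCν1)
  have b7 : 4 * M.CDFinv * M.CDF * M.ν0 ≤ M.ν1 := by nlinarith
  exact ⟨by linarith, by linarith, by linarith, b7, by nlinarith⟩

/-- This is the purpose of the summand `0.1` in the rule for `Cz`. -/
theorem norm2_le_Cz_of_near (h : M.Admissible P) (hn : 0 < n) (hτ : 0 < τ)
    (hτA : τ ≤ M.τA) (hz₀ : z₀ ∈ Nbhd P M τ) (hd : norm2 (z - z₀) ≤ 0.1) : norm2 z ≤ M.Cz := by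
  have h1 := Nbhd.norm2_le h hn hτ hτA hz₀
  have h2 := norm2_add_le (z - z₀) z₀
  rw [sub_add_cancel] at h2
  linarith

theorem norm2_le_CDFinv_mul (h : M.Admissible P) (hn : 0 < n) (hτE : M.τE ≤ τ)
    (hτA : τ ≤ M.τA) (hz₀ : z₀ ∈ Nbhd P M τ) (hd : norm2 (z - z₀) ≤ 0.1)
    (hdg : norm2 (z - z₀) ≤ M.gap) (u : PD n m) :
    norm2 u ≤ M.CDFinv * norm2 ((DF P M.ω z).mulVec u) := by
  have hEA := hτE.trans hτA
  have hτ := h.τE_pos.trans_le hτE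
  obtain ⟨h1, h2, -⟩ := h.cond_facts hn hEA
  have hZ := norm2_le_Cz_of_near h hn hτ hτA hz₀ hd
  have hd' : ∀ s, |z s - z₀ s| ≤ M.gap := fun s => (abs_le_norm2 (z - z₀) s).trans hdg
  have hz' : ∀ s, z s ≤ M.Cz := fun s =>
    (le_abs_self _).trans ((abs_le_norm2 z s).trans hZ)
  have hg := fun i => Nbhd.gap_le h hn hτE hτA hz₀ i
  refine norm2_le_mul_norm2_DF_mulVec P M.ω z u h.gap_pos (h.gap_facts hn hEA).2 h.ω_pos
    (zero_lt_one.trans_le (h.bounds_le_Cz hn).1) h1 h2 (fun i => ?_) (fun i => ?_)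
    (fun i => ⟨?_, hz' _⟩) (fun i => ⟨?_, hz' _⟩)
  · have a := (abs_le.1 (hd' (.inl i))).1
    have b := (hg i).1
    simp only [PD.x] at *
    linarith
  · have a := (abs_le.1 (hd' (.inl i))).2
    have b := (hg i).2.1
    simp only [PD.x] at *
    linarith
  · have a := (abs_le.1 (hd' (.inr (.inr (.inl i))))).1
    have b := (hg i).2.2.1
    simp only [PD.muL] at *
    linarith
  · have a := (abs_le.1 (hd' (.inr (.inr (.inr i))))).1
    have b := (hg i).2.2.2
    simp only [PD.muR] at *
    linarith

/-- Newton steps from nearby points lead to nearby points. -/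
theorem DF_mulVec_newton_sub (ω : ℝ) (τ' : ℝ) {w w₀ : PD n m}
    (hw₀ : (DF P ω z₀).mulVec w₀ = -F P ω τ' z₀) (hw : (DF P ω z).mulVec w = -F P ω τ' z) :
    (DF P ω z).mulVec (z + w - (z₀ + w₀)) =
      (1 / 2 : ℝ) • bil (z - z₀) (z - z₀) - bil (z - z₀) w₀ := by
  obtain ⟨d, rfl⟩ : ∃ d, z = z₀ + d := ⟨z - z₀, by abel⟩
  rw [add_sub_cancel_left] at *
  -- Both expansions about `z₀` are exact; the terms `F z₀` and `DF z₀ d` cancel, leaving only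
  -- second-order ones.
  rw [show z₀ + d + w - (z₀ + w₀) = d + w - w₀ by abel, Matrix.mulVec_sub, Matrix.mulVec_add, hw,
    DF_add_mulVec, DF_add_mulVec, hw₀, F_add]
  funext s
  simp only [Pi.add_apply, Pi.sub_apply, Pi.neg_apply, Pi.smul_apply, smul_eq_mul]
  ring

/-- The exact Newton step from a point near `𝒩(τ)` leads near `𝒩(σ τ)`. -/
theorem exists_mem_Nbhd_near_newton (h : M.Admissible P) (hn : 0 < n) (hτE : M.τE ≤ τ)
    (hτA : τ ≤ M.τA) (hz₀ : z₀ ∈ Nbhd P M τ) (hd : norm2 (z - z₀) ≤ M.ν0) {w : PD n m}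
    (hw : (DF P M.ω z).mulVec w = -F P M.ω (M.σ * τ) z) :
    ∃ z₁ ∈ Nbhd P M (M.σ * τ), norm2 (z + w - z₁) ≤ M.ν1 / 4 ∧ norm2 w ≤ 3 * M.Cz := by
  have hEA := hτE.trans hτA
  have hτ := h.τE_pos.trans_le hτE
  obtain ⟨hν0g, hν0, hν1, hν01, -⟩ := h.radius_facts hn hEA
  obtain ⟨-, -, hinv1, hCDF, -⟩ := h.cond_facts hn hEA
  have hCz1 := (h.bounds_le_Cz hn).1
  have hσ0 : 0 < M.σ := lt_of_lt_of_le (by norm_num) (h.σ_ge' hn)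
  have hστ : 0 < M.σ * τ := mul_pos hσ0 hτ
  have hστA : M.σ * τ ≤ M.τA := (mul_le_of_le_one_left hτ.le h.σ_lt.le).trans hτA
  have hbound := norm2_le_CDFinv_mul h hn hτE hτA hz₀ (hd.trans hν0) (hd.trans hν0g)
  have hbound₀ := norm2_le_CDFinv_mul (z := z₀) h hn hτE hτA hz₀
    (by rw [sub_self, norm2_zero]; norm_num) (by rw [sub_self, norm2_zero]; exact h.gap_pos.le)
  have hz := norm2_le_Cz_of_near h hn hτ hτA hz₀ (hd.trans hν0)
  obtain ⟨w₀, hw₀⟩ := exists_mulVec_eq (isUnit_det_of_norm2_le hbound₀) (-F P M.ω (M.σ * τ) z₀)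
  have hnew := Nbhd.add_mem h hn hτ hz₀ hw₀
  have hz₀n := Nbhd.norm2_le h hn hτ hτA hz₀
  have hnewn := Nbhd.norm2_le h hn hστ hστA hnew
  norm_num at hz₀n hnewn hν0 hν1
  have hexact : norm2 (z + w - (z₀ + w₀)) ≤ M.ν1 / 4 := by
    have h1 := hbound (z + w - (z₀ + w₀))
    rw [DF_mulVec_newton_sub M.ω (M.σ * τ) hw₀ hw] at h1
    have h2 := norm2_sub_le ((1 / 2 : ℝ) • bil (z - z₀) (z - z₀)) (bil (z - z₀) w₀)
    have h3 := norm2_smul (1 / 2) (bil (z - z₀) (z - z₀))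
    rw [abs_of_pos (by norm_num)] at h3
    have h4 := norm2_bil_le (z - z₀) (z - z₀)
    have h5 := norm2_bil_le (z - z₀) w₀
    have h6 : norm2 w₀ ≤ 2 * M.Cz := by
      have := norm2_sub_le (z₀ + w₀) z₀
      rw [add_sub_cancel_left] at this
      linarith
    have h7 : norm2 (z - z₀) * norm2 (z - z₀) ≤ M.ν0 * 1 :=
      mul_le_mul hd (by linarith) (norm2_nonneg _) h.ν0_pos.le
    have h8 : norm2 (z - z₀) * norm2 w₀ ≤ M.ν0 * (2 * M.Cz) :=
      mul_le_mul hd h6 (norm2_nonneg _) h.ν0_pos.le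
    have h9 : norm2 ((1 / 2 : ℝ) • bil (z - z₀) (z - z₀) - bil (z - z₀) w₀) ≤ M.CDF * M.ν0 := by
      have := mul_le_mul_of_nonneg_right hCDF h.ν0_pos.le
      linarith [h.ν0_pos]
    have h10 := mul_le_mul_of_nonneg_left h9 (zero_le_one.trans hinv1)
    linarith
  refine ⟨z₀ + w₀, hnew, hexact, ?_⟩
  have h1 := norm2_add_le (z + w - (z₀ + w₀)) (z₀ + w₀)
  rw [sub_add_cancel] at h1
  have h2 := norm2_sub_le (z + w) z
  rw [add_sub_cancel_left] at h2
  linarith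

end Main
end BoxQP

theorem mainTheorem4 (n m : ℕ) (hn : 0 < n) (C : ℝ) (hC : 0 ≤ C) :
    ∃ K : ℝ, 0 < K ∧
      ∀ (P : Problem n m) (M : Params), M.Admissible P →
      ∀ (ε : ℝ) (fl : ℝ → ℝ)
        (solve : Matrix (Idx n m) (Idx n m) ℝ → (Idx n m → ℝ) → (Idx n m → ℝ)),
        0 < ε → K * ε ≤ M.ν0 / (4 * M.Cz * M.κDF) →
        IsRounding ε fl → IsStableSolver C ε solve →
      ∀ τ ∈ Set.Icc M.τE M.τA, ∀ z ∈ EnvNbhd P M τ M.ν0,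
        IsUnit (DF P M.ω z).det ∧
        ∀ zhat : PD n m, IsComputedNewtonStep fl solve P M.ω (M.σ * τ) z zhat →
          zhat ∈ EnvNbhd P M (M.σ * τ) M.ν1 := by
  set N : ℝ := (Fintype.card (Idx n m) : ℝ) with hN
  have hN0 : 0 ≤ N := Nat.cast_nonneg _
  set c : ℝ := (2 ^ (n + m + 4) * 4 + 3) * (n + m + 4) with hc
  have hc0 : 0 ≤ c := by positivity
  -- The summands pay for the Jacobian error (`N * N` entries), the residual error (`N` entries),
  -- and the bound `3 * Cz` for the exact step.
  set a : ℝ := 3 * (N * N) + N * c + 3 with ha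
  have hNN : 0 ≤ N * N := by positivity
  have hNc : 0 ≤ N * c := by positivity
  have ha1 : 1 ≤ a := by linarith
  set c' : ℝ := 10 * (C + 1) * a ^ 2 with hc'
  have hc'0 : 0 ≤ c' := by positivity
  have hs0 : 0 ≤ 16 * (C + 1) * a := by positivity
  -- `c'` covers the solver error, 5 the rounded update of a vector of norm at most `5 * Cz`, and
  -- the last summand the smallness condition of the solver estimate.
  refine ⟨c' + 5 + 16 * (C + 1) * a, by positivity, ?_⟩
  intro P M h ε fl solve hε hK hfl hsolve τ ⟨hτE, hτA⟩ z ⟨z₀, hz₀, hd⟩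
  have hEA := hτE.trans hτA
  have hτ := h.τE_pos.trans_le hτE
  obtain ⟨hν0g, hν0, hν1, hν01, hν01'⟩ := h.radius_facts hn hEA
  obtain ⟨-, -, hinv1, hCDF, hκ1⟩ := h.cond_facts hn hEA
  obtain ⟨hCz1, hClam, hCmu⟩ := h.bounds_le_Cz hn
  have hCzA : M.CDmu + (1 + M.θ) * M.τA ≤ M.Cz := (h.CDmu_add_le hn).trans hCmu
  have hCDmu : 0 ≤ M.CDmu := (norm2_nonneg _).trans h.norm2_c_le
  have hθτA : 0 ≤ M.θ * M.τA := mul_nonneg h.θ_pos.le h.τA_nonneg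
  have hσ0 : 0 < M.σ := lt_of_lt_of_le (by norm_num) (h.σ_ge' hn)
  have hστ : 0 < M.σ * τ := mul_pos hσ0 hτ
  have hστA : M.σ * τ ≤ M.τA := 
    (mul_le_of_le_one_left hτ.le h.σ_lt.le).trans hτA
  have hω := h.ω_pos
  have hbound := norm2_le_CDFinv_mul h hn hτE hτA hz₀ (hd.trans hν0) (hd.trans hν0g)
  have hz := norm2_le_Cz_of_near h hn hτ hτA hz₀ (hd.trans hν0)
  refine ⟨isUnit_det_of_norm2_le hbound, ?_⟩
  rintro zhat ⟨r, hr, hzhat⟩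
  obtain ⟨w, hw⟩ := exists_mulVec_eq (isUnit_det_of_norm2_le hbound) (-F P M.ω (M.σ * τ) z)
  obtain ⟨z₁, hz₁, hexact, hwn⟩ := exists_mem_Nbhd_near_newton h hn hτE hτA hz₀ hd hw
  refine ⟨z₁, hz₁, ?_⟩
  norm_num at hν0
  -- the size of the rounding errors
  have hKε : (c' + 5 + 16 * (C + 1) * a) * (ε * M.κDF * M.Cz) ≤ M.ν0 / 4 := by
    rw [le_div_iff₀ (by positivity)] at hK
    linarith
  have hε0 : 0 ≤ ε * M.κDF * M.Cz := by positivity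
  have hεκ : ε * M.κDF ≤ ε * M.κDF * M.Cz := le_mul_of_one_le_right (by positivity) hCz1
  have hεle : ε ≤ ε * M.κDF := le_mul_of_one_le_right hε.le hκ1
  have hparts : c' * (ε * M.κDF * M.Cz) + 5 * (ε * M.κDF * M.Cz) ≤ M.ν0 / 4 ∧
      16 * (C + 1) * a * (ε * M.κDF * M.Cz) ≤ 1 ∧ 5 * (ε * M.κDF * M.Cz) ≤ 1 := by
    have h1 : 0 ≤ c' * (ε * M.κDF * M.Cz) := by positivity
    have h2 : 0 ≤ 16 * (C + 1) * a * (ε * M.κDF * M.Cz) := by positivity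
    refine ⟨?_, ?_, ?_⟩ <;> linarith
  have hε1 : ε ≤ 1 := by linarith
  have hsmall : 16 * (C + 1) * a * (ε * M.κDF) ≤ 1 :=
    (mul_le_mul_of_nonneg_left hεκ hs0).trans hparts.2.1
  -- the solver
  have hQop := opNorm_nonneg P.Q
  have hfrob : 0 ≤ frobNorm P.A := Real.sqrt_nonneg _
  have hCDFge := h.CDF_ge
  have hQ : ∀ i j, |P.Q i j| + M.ω ≤ M.CDF := fun i j => by
    linarith [abs_apply_le_opNorm P.Q i j]
  have hQ' : ∀ i j, |P.Q i j| ≤ M.CDF := fun i j => by linarith [hQ i j]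
  have hA : ∀ k j, |P.A k j| ≤ M.CDF := fun k j => by
    linarith [abs_apply_le_frobNorm P.A k j]
  have hωD : M.ω ≤ M.CDF := by linarith
  have hD : 1 + M.Cz ≤ M.CDF := by linarith
  have hzs : ∀ s, |z s| ≤ M.Cz := fun s => (abs_le_norm2 z s).trans hz
  have hCz0 : 0 ≤ M.Cz := zero_le_one.trans hCz1
  have hCDF0 : 0 ≤ M.CDF := by linarith
  have hrhs : norm2 (-r - (DF P M.ω z).mulVec w) ≤ a * ε * M.CDF * M.Cz := by
    have h1 : norm2 (r - F P M.ω (M.σ * τ) z) ≤ N * (c * ε * (M.CDF * M.Cz)) := by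
      refine norm2_le_card_mul fun s => ?_
      refine hr.abs_sub_le hfl hε.le hε1 hω.le hCz0 hQ' hA hωD hD hzs (fun i => ?_) (fun k => ?_)
        ?_ s
      · linarith [abs_le_norm2 P.c i, h.norm2_c_le, h.τA_nonneg]
      · linarith [abs_le_norm2 P.b k, h.norm2_b_le]
      · rw [abs_of_pos hστ]; linarith
    rw [hw, neg_sub_neg, norm2_sub_comm]
    refine h1.trans ?_
    have h2 : N * c ≤ a := by linarith
    have h3 := mul_le_mul_of_nonneg_right h2
      (mul_nonneg hε.le (mul_nonneg hCDF0 hCz0))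
    linarith
  have hsol := hsolve.norm2_solve_sub_le hC hε.le hε1 (G₀ := DF P M.ω z) (G := computedDF fl P M.ω z)
    (v := -r) (w := w) ha1 (zero_le_one.trans hinv1) hCDF0 hCz0 h.κDF_ge hκ1 hsmall hbound
    (fun u => by
      refine (norm2_mulVec_le_of_abs_le
        (abs_DF_le hω.le hQ hA hωD hD hCz0 hzs) u).trans ?_
      have h1 : N * N ≤ a := by linarith
      have := norm2_nonneg u
      gcongr)
    (fun u => by
      refine (norm2_mulVec_le_of_abs_le
        (computedDF_sub_le hfl hε.le hε1 hω.le hQ hA hωD hD hzs) u).trans ?_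
      have h1 : 3 * (N * N) ≤ a := by linarith
      have h2 := mul_le_mul_of_nonneg_right h1
        (mul_nonneg (mul_nonneg hε.le hCDF0) (norm2_nonneg u))
      linarith)
    hrhs (hwn.trans (mul_le_mul_of_nonneg_right (by linarith) hCz0))
  set u := solve (computedDF fl P M.ω z) (-r) with hu
  have hsol' : norm2 (u - w) ≤ c' * (ε * M.κDF * M.Cz) := by
    rw [mul_assoc] at hsol ⊢
    linarith
  -- the update
  have hzu : norm2 (z + u) ≤ 5 * M.Cz := by
    have h1 := norm2_add_le z u
    have h2 := norm2_add_le (u - w) w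
    rw [sub_add_cancel] at h2
    linarith
  have hupd : norm2 (zhat - (z + u)) ≤ 5 * (ε * M.κDF * M.Cz) := by
    have h1 : norm2 (zhat - (z + u)) ≤ ε * norm2 (z + u) :=
      norm2_le_mul_of_abs_le hε.le fun s => by
        simp only [Pi.sub_apply, Pi.add_apply, hzhat s]
        exact hfl _
    have h2 := mul_le_mul_of_nonneg_left hzu hε.le
    have h3 := mul_le_mul_of_nonneg_right hεle hCz0
    linarith
  have htri : norm2 (zhat - z₁) ≤
      norm2 (zhat - (z + u)) + norm2 (u - w) + norm2 (z + w - z₁) := by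
    have h1 := norm2_add_le (zhat - (z + u) + (u - w)) (z + w - z₁)
    have h2 := norm2_add_le (zhat - (z + u)) (u - w)
    rw [show zhat - (z + u) + (u - w) + (z + w - z₁) = zhat - z₁ by abel] at h1
    linarith
  -- Update and solver errors together are at most `ν0 / 4`, the exact step contributes `ν1 / 4`,
  -- and `4 * ν0 ≤ ν1`.
  linarith [hparts.1, h.ν0_pos]
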